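/- Let $a,b>0$, set $\psi(\xi)=4\pi^2\xi^2-a|\xi|^{4/3}+i\,b\,\xi|\xi|^{1/3}$ and, for $t>0$, let $K(t,\cdot)=\mathcal F^{-1}(e^{-t\psi})$, where $\mathcal F f(\xi)=\int_{\mathbf R}e^{-2i\pi x\xi}f(x)\,dx$. The Fowler equation $\partial_t u+\partial_x(u^2/2)+\mathcal I[u]-\partial_x^2u=0$ is considered on $\mathbf R$, where $\mathcal I$ is the Fourier multiplier with symbol $-a|\xi|^{4/3}+i\,b\,\xi|\xi|^{1/3}$; for suitable $a,b>0$ this is the nonlocal operator $\mathcal I[\varphi](x)=\int_0^{\infty}\zeta^{-1/3}\varphi''(x-\zeta)\,d\zeta$. For $n\in\mathbf N$ let $H^n(\mathbf R)$ be the Sobolev space of real-valued functions, with norm $\|f\|_{H^n}=\big(\int_{\mathbf R}(1+\xi^2)^n|\mathcal Ff(\xi)|^2\,d\xi\big)^{1/2}$; in particular $H^0=L^2$. A mild solution in $C([0,T];H^n(\mathbf R))$ with initial value $u_0$ is a function $u\in C([0,T];H^n(\mathbf R))$ with $u(0)=u_0$ and, for all $t\in(0,T]$, $$u(t)=K(t,\cdot)*u_0-\frac12\int_0^t\partial_xK(t-s,\cdot)*u(s)^2\,ds\quad\text{almost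 everywhere in }\mathbf R.$$ **Lemma.** Let $n\ge1$ be an integer. There is a function $(T,r)\mapsto C_T(r)>0$, nondecreasing in $T$ and in $r$ (and depending only on $n,a,b$), such that for every $T>0$ and every $u_0\in H^n(\mathbf R)$ there is a unique mild solution $u\in C([0,T];H^n(\mathbf R))$ with initial value $u_0$, and it satisfies, for all $t\in[0,T]$, $$\|u(t)\|_{H^n(\mathbf R)}\le C_T\big(\|u_0\|_{H^{n-1}(\mathbf R)}\big)\,\|u_0\|_{H^n(\mathbf R)}.$$ -/

import Mathlib

open MeasureTheory Set Filter Topology FourierTransform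
open scoped ENNReal SchwartzMap

noncomputable section

namespace Fowler

/-- The real Hilbert space `L²(ℝ)` of real-valued functions. -/
abbrev L2R : Type := Lp ℝ 2 (volume : Measure ℝ)

/-- A real-valued `L²` function, viewed as a complex-valued one. -/
def toComplex (f : L2R) : Lp ℂ 2 (volume : Measure ℝ) :=
  Complex.ofRealCLM.compLp f

/-- The Fourier transform of `f ∈ L²(ℝ)`, for the normalization
`𝓕 f ξ = ∫ e^{-2iπxξ} f(x) dx`. -/
def fourierL2 (f : L2R) : Lp ℂ 2 (volume : Measure ℝ) := 𝓕 (toComplex f)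

/-- Membership of `f` in the Sobolev space `Hⁿ(ℝ)`. -/
def MemH (n : ℕ) (f : L2R) : Prop :=
  TemperedDistribution.MemSobolev (n : ℝ) 2 (toComplex f : 𝓢'(ℝ, ℂ))

/-- The Sobolev norm `‖f‖_{Hⁿ} = (∫ (1 + ξ²)ⁿ |𝓕 f ξ|² dξ)^{1/2}`, to be used for `f ∈ Hⁿ(ℝ)`. -/
def normH (n : ℕ) (f : L2R) : ℝ :=
  Real.sqrt (∫ ξ : ℝ, (1 + ξ ^ 2) ^ n * ‖fourierL2 f ξ‖ ^ 2)

/-- A function is in `Hⁿ(ℝ)` exactly when the integral that defines its norm is finite. -/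
theorem memH_iff_integrable (n : ℕ) (f : L2R) :
    MemH n f ↔ Integrable (fun ξ : ℝ => (1 + ξ ^ 2) ^ n * ‖fourierL2 f ξ‖ ^ 2) := by
  set w : ℝ → ℂ := fun ξ => (((1 + ‖ξ‖ ^ 2) ^ ((n : ℝ) / 2) : ℝ) : ℂ) with hw
  have hwg : w.HasTemperateGrowth := by
    have := Function.hasTemperateGrowth_one_add_norm_sq_rpow ℝ ((n : ℝ) / 2)
    simp only [hw]
    fun_prop
  have hwc : Continuous w := hwg.1.continuous
  have hae : AEStronglyMeasurable (fun ξ => w ξ * fourierL2 f ξ) volume :=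
    hwc.aestronglyMeasurable.mul (Lp.aestronglyMeasurable _)
  have hkey : MemLp (fun ξ => w ξ * fourierL2 f ξ) 2 volume ↔
      Integrable (fun ξ : ℝ => (1 + ξ ^ 2) ^ n * ‖fourierL2 f ξ‖ ^ 2) := by
    rw [memLp_two_iff_integrable_sq_norm hae]
    refine integrable_congr (Eventually.of_forall fun ξ => ?_)
    have h0 : (0 : ℝ) ≤ 1 + ‖ξ‖ ^ 2 := by positivity
    simp only [hw, norm_mul, mul_pow, Complex.norm_real]
    congr 1
    rw [Real.norm_of_nonneg (Real.rpow_nonneg h0 _), ← Real.rpow_natCast, ← Real.rpow_mul h0]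
    norm_num
  rw [MemH, TemperedDistribution.memSobolev_iff_exists_smulLeftCLM_fourier,
    Lp.fourier_toTemperedDistribution_eq, ← hkey]
  constructor
  · rintro ⟨g, hg⟩
    refine (memLp_congr_ae ?_).mp (Lp.memLp g)
    symm
    refine ae_eq_of_integral_contDiff_smul_eq (μ := volume) ?_ ?_ ?_
    · have h1 : LocallyIntegrable (fourierL2 f) volume :=
        (Lp.memLp (fourierL2 f)).locallyIntegrable (by norm_num)
      rw [← locallyIntegrableOn_univ] at h1 ⊢
      exact h1.continuousOn_mul hwc.continuousOn isOpen_univ.isLocallyClosed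
    · exact (Lp.memLp g).locallyIntegrable (by norm_num)
    · intro φ φ_smooth φ_cpt
      have h1 : HasCompactSupport (Complex.ofRealCLM ∘ φ) := φ_cpt.comp_left rfl
      have h2 : ContDiff ℝ (⊤ : ℕ∞) (Complex.ofRealCLM ∘ φ) := by fun_prop
      have h3 := congrArg (fun S : 𝓢'(ℝ, ℂ) => S (h1.toSchwartzMap h2)) hg
      simp only [TemperedDistribution.smulLeftCLM_apply_apply,
        Lp.toTemperedDistribution_apply] at h3
      have h4 : ∀ ξ, SchwartzMap.smulLeftCLM ℂ w (h1.toSchwartzMap h2) ξ = w ξ * φ ξ := fun ξ => by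
        rw [SchwartzMap.smulLeftCLM_apply_apply hwg]; simp
      calc _ = ∫ ξ, SchwartzMap.smulLeftCLM ℂ w (h1.toSchwartzMap h2) ξ • fourierL2 f ξ := by
            refine integral_congr_ae (Eventually.of_forall fun ξ => ?_)
            simp only [h4, smul_eq_mul, Complex.real_smul]
            ring
        _ = _ := h3
        _ = _ := by simp
  · intro h
    refine ⟨h.toLp _, ?_⟩
    ext φ
    simp only [TemperedDistribution.smulLeftCLM_apply_apply, Lp.toTemperedDistribution_apply]
    refine integral_congr_ae ?_
    filter_upwards [h.coeFn_toLp] with ξ hξ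
    rw [hξ, SchwartzMap.smulLeftCLM_apply_apply hwg]
    simp only [smul_eq_mul]
    rw [fourierL2]
    ring

/-- The symbol `ψ(ξ) = 4π²ξ² - a|ξ|^{4/3} + i b ξ|ξ|^{1/3}` of the operator `𝓘 - ∂ₓ²`. -/
def psi (a b ξ : ℝ) : ℂ :=
  ((4 * Real.pi ^ 2 * ξ ^ 2 - a * |ξ| ^ (4 / 3 : ℝ) : ℝ) : ℂ)
    + Complex.I * ((b * ξ * |ξ| ^ (1 / 3 : ℝ) : ℝ) : ℂ)

/-- The kernel `K(t, ·) = 𝓕⁻¹(e^{-tψ})`, for `t > 0`. -/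
def K (a b t : ℝ) : ℝ → ℂ :=
  𝓕⁻ (fun ξ : ℝ => Complex.exp (-(t : ℂ) * psi a b ξ))

/-- The space derivative `∂ₓK(t, ·)`, for `t > 0`. -/
def dxK (a b t : ℝ) : ℝ → ℂ := deriv (K a b t)

/-- The convolution `k ∗ f` on `ℝ` of a complex kernel with a real function. -/
def conv (k : ℝ → ℂ) (f : ℝ → ℝ) : ℝ → ℂ :=
  convolution k (fun y => (f y : ℂ)) (ContinuousLinearMap.mul ℂ ℂ) volume

/-- `u ∈ C([0,T]; Hⁿ(ℝ))`. -/
def ContinuousInH (n : ℕ) (T : ℝ) (u : ℝ → L2R) : Prop :=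
  (∀ t ∈ Icc 0 T, MemH n (u t)) ∧
    ∀ t ∈ Icc 0 T, Tendsto (fun s => normH n (u s - u t)) (𝓝[Icc 0 T] t) (𝓝 0)

/-- `u ∈ C([0,T]; Hⁿ(ℝ))` is a mild solution of the Fowler equation with initial value `u₀`:
`u(0) = u₀`, and for `0 < t ≤ T` the Duhamel formula
`u(t) = K(t) ∗ u₀ - (1/2) ∫₀ᵗ ∂ₓK(t-s) ∗ u(s)² ds` holds almost everywhere in `ℝ`. Only the values
of `u` on `[0,T]` matter. -/
structure IsMildSolution (a b : ℝ) (n : ℕ) (T : ℝ) (u₀ : L2R) (u : ℝ → L2R) : Prop where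
  continuousInH : ContinuousInH n T u
  initial : u 0 = u₀
  duhamel : ∀ t ∈ Ioc 0 T, ∀ᵐ x : ℝ,
    ((u t x : ℝ) : ℂ) = conv (K a b t) u₀ x
      - (1 / 2) * ∫ s in (0 : ℝ)..t, conv (dxK a b (t - s)) (fun y => (u s y) ^ 2) x

end Fowler

end

noncomputable section

namespace Fowler

/-! Everything is done on the Fourier side, where the Duhamel formula reads û(t) = e^{-tψ} û₀ - πiξ
∫₀ᵗ e^{-(t-s)ψ} 𝓕(u²)(s) ds. Since Re ψ ≥ ξ² - a³ (`le_psi_re`), a source of size e^{(a³+μ)s} gives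
a Duhamel term of size e^{(a³+μ)t} |ξ|/(ξ²+μ) ≤ e^{(a³+μ)t} (ξ²+μ)^{-1/2} (`norm_duhamel_le`). This
profile is in L², with norm of order μ^{-1/4} (`n2_kf`). A sup bound on 𝓕(u²) thus yields an L²
bound on û, with a constant that is small for large μ.

The sup bounds come from Cauchy–Schwarz: |𝓕(u²)| ≤ ‖u‖², and, for a subadditive weight w, w|𝓕(u²)| ≤
C ‖u‖ ‖wû‖ (`IsWeight.mul_norm_fourierMul_self_le`). The second bound is linear in the weighted
norm, and its other factor is only the L² norm.

To solve on all of [0,T] at once, u is replaced in the nonlinearity by its radial retraction onto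
the L² ball of radius R. The nonlinearity is then globally Lipschitz, and an exponentially weighted
norm gives a contraction (`exists_truncSol`, `TruncSol.unique`). The tame bound propagates the Hⁿ
norm with a constant depending on R and T only (`TruncSol.memW_and_nw_le`).

The flux is orthogonal to u, also after truncation (`integral_mul_fourierMul_self`,
`integral_mul_trunc`), whence ‖u(t)‖ ≤ e^{a³t} ‖u₀‖ independently of R (`TruncSol.norm_le`). For R
above e^{a³T} ‖u₀‖_{H^{n-1}} the truncation is therefore never active, u is a mild solution, and the
Hⁿ bound has the stated form. Conversely, every mild solution solves the truncated problem for large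
R, which gives uniqueness. -/

/-- The complex Hilbert space `L²(ℝ)`. -/
abbrev L2C : Type := Lp ℂ 2 (volume : Measure ℝ)

/-! ### The L² Fourier transform through duality. -/

theorem integrable_mul_L2 {f g : ℝ → ℂ} (hf : MemLp f 2) (hg : MemLp g 2) :
    Integrable (fun x => f x * g x) := by
  have := hf.integrable_mul hg
  exact this

theorem integral_fourier_schwartz_mul (φ : 𝓢(ℝ, ℂ)) (f : L2C) :
    ∫ x, 𝓕 (φ : ℝ → ℂ) x * f x = ∫ x, φ x * (𝓕 f : L2C) x := by
  have h := congrArg (fun S : 𝓢'(ℝ, ℂ) => S φ) (Lp.fourier_toTemperedDistribution_eq f)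
  simp only [TemperedDistribution.fourier_apply, Lp.toTemperedDistribution_apply,
    smul_eq_mul] at h
  rw [← h]
  rfl

theorem integral_fourier_mul_flip {f g : ℝ → ℂ} (hf : Integrable f) (hg : Integrable g) :
    ∫ x, 𝓕 f x * g x = ∫ x, f x * 𝓕 g x := by
  have := VectorFourier.integral_fourierIntegral_smul_eq_flip (L := innerₗ ℝ)
    Real.continuous_fourierChar continuous_inner hf hg
  simp only [flip_innerₗ, smul_eq_mul] at this
  exact this

theorem continuous_fourier {f : ℝ → ℂ} (hf : Integrable f) : Continuous (𝓕 f) :=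
  VectorFourier.fourierIntegral_continuous Real.continuous_fourierChar
    (innerSL ℝ).continuous₂ hf

/-- Compactly supported smooth functions separate locally integrable functions, so a transform that
is defined by density can be identified by testing. -/
theorem fourier_ae_eq_of_schwartz {f : L2C} {H : ℝ → ℂ} (hH : LocallyIntegrable H)
    (hd : ∀ φ : 𝓢(ℝ, ℂ), HasCompactSupport φ → ∫ x, 𝓕 (φ : ℝ → ℂ) x * f x = ∫ x, φ x * H x) :
    ((𝓕 f : L2C) : ℝ → ℂ) =ᵐ[volume] H := by
  refine ae_eq_of_integral_contDiff_smul_eq (μ := volume)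
    ((Lp.memLp _).locallyIntegrable (by norm_num)) hH ?_
  intro φ φ_smooth φ_cpt
  have h1 : HasCompactSupport (Complex.ofRealCLM ∘ φ) := φ_cpt.comp_left rfl
  have h2 : ContDiff ℝ (⊤ : ℕ∞) (Complex.ofRealCLM ∘ φ) := by fun_prop
  have h3 := hd (h1.toSchwartzMap h2) h1
  rw [integral_fourier_schwartz_mul] at h3
  simpa using h3

theorem fourier_coe_ae_eq {f : L2C} (hf : Integrable f) :
    ((𝓕 f : L2C) : ℝ → ℂ) =ᵐ[volume] 𝓕 (f : ℝ → ℂ) := by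
  refine fourier_ae_eq_of_schwartz (continuous_fourier hf).locallyIntegrable fun φ _ => ?_
  exact integral_fourier_mul_flip φ.integrable hf

theorem fourier_toLp_ae_eq {m : ℝ → ℂ} (h1 : Integrable m) (h2 : MemLp m 2) :
    ((𝓕 (h2.toLp m) : L2C) : ℝ → ℂ) =ᵐ[volume] 𝓕 m := by
  have h3 : Integrable (h2.toLp m) := h1.congr h2.coeFn_toLp.symm
  refine (fourier_coe_ae_eq h3).trans (Eventually.of_forall fun x => ?_)
  exact Real.fourier_congr_ae h2.coeFn_toLp x

/-- The bilinear pairing `∫ f g` on `L²`. -/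
theorem continuous_integral_mul (f : L2C) : Continuous fun g : L2C => ∫ x, f x * g x := by
  have h : ∀ g : L2C, ∫ x, f x * g x = (ContinuousLinearMap.mul ℂ ℂ).lpPairing volume 2 2 f g :=
    fun g => by rw [ContinuousLinearMap.lpPairing_eq_integral]; rfl
  simp_rw [h]
  fun_prop

theorem integral_fourier_mul_L2 (f g : L2C) :
    ∫ x, (𝓕 f : L2C) x * g x = ∫ x, f x * (𝓕 g : L2C) x := by
  set p := fun f : L2C => ∫ x, (𝓕 f : L2C) x * g x = ∫ x, f x * (𝓕 g : L2C) x
  apply DenseRange.induction_on (p := p)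
    (SchwartzMap.denseRange_toLpCLM (p := 2) (F := ℂ) (E := ℝ) (μ := volume) ENNReal.ofNat_ne_top) f
  · apply isClosed_eq
    · have := (continuous_integral_mul g).comp
        (Lp.fourierTransformₗᵢ ℝ ℂ).continuous
      refine this.congr fun f => ?_
      simp only [Function.comp, mul_comm]
      rfl
    · exact (continuous_integral_mul (𝓕 g)).congr fun f => by simp only [mul_comm]
  intro φ
  simp only [p, SchwartzMap.toLpCLM_apply]
  rw [SchwartzMap.toLp_fourier_eq]
  have e1 := SchwartzMap.coeFn_toLp (𝓕 φ) 2 (volume : Measure ℝ)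
  have e2 := SchwartzMap.coeFn_toLp φ 2 (volume : Measure ℝ)
  rw [integral_congr_ae (g := fun x => 𝓕 (φ : ℝ → ℂ) x * g x), integral_fourier_schwartz_mul]
  · refine integral_congr_ae ?_
    filter_upwards [e2] with x hx
    rw [hx]
  · filter_upwards [e1] with x hx
    rw [hx, SchwartzMap.fourier_coe]

theorem integral_fourier_mul {m : ℝ → ℂ} (h1 : Integrable m) (h2 : MemLp m 2) (f : L2C) :
    ∫ x, 𝓕 m x * f x = ∫ x, m x * (𝓕 f : L2C) x := by
  have e1 : ∫ x, 𝓕 m x * f x = ∫ x, (𝓕 (h2.toLp m) : L2C) x * f x := by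
    refine integral_congr_ae ?_
    filter_upwards [fourier_toLp_ae_eq h1 h2] with x hx
    rw [hx]
  rw [e1, integral_fourier_mul_L2]
  refine integral_congr_ae ?_
  filter_upwards [h2.coeFn_toLp] with x hx
  rw [hx]

/-- Characterization of the `L²` Fourier transform by duality. -/
theorem fourier_ae_eq_of_dual {f : L2C} {H : ℝ → ℂ} (hH : LocallyIntegrable H)
    (hd : ∀ m : ℝ → ℂ, Integrable m → MemLp m 2 → ∫ x, 𝓕 m x * f x = ∫ x, m x * H x) :
    ((𝓕 f : L2C) : ℝ → ℂ) =ᵐ[volume] H :=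
  fourier_ae_eq_of_schwartz hH fun φ _ => hd φ φ.integrable (φ.memLp 2)

theorem integral_fourierInv_schwartz_mul (φ : 𝓢(ℝ, ℂ)) (f : L2C) :
    ∫ x, 𝓕⁻ (φ : ℝ → ℂ) x * f x = ∫ x, φ x * (𝓕⁻ f : L2C) x := by
  have h := congrArg (fun S : 𝓢'(ℝ, ℂ) => S φ) (Lp.fourierInv_toTemperedDistribution_eq f)
  simp only [TemperedDistribution.fourierInv_apply, Lp.toTemperedDistribution_apply,
    smul_eq_mul, SchwartzMap.fourierInv_coe] at h
  exact h

theorem integral_fourierInv_mul_flip {f g : ℝ → ℂ} (hf : Integrable f) (hg : Integrable g) :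
    ∫ x, 𝓕⁻ f x * g x = ∫ x, f x * 𝓕⁻ g x := by
  rw [Real.fourierInv_eq_fourier_comp_neg f, integral_fourier_mul_flip hf.comp_neg hg,
    ← integral_neg_eq_self (fun x => f x * 𝓕⁻ g x)]
  simp only [Real.fourierInv_eq_fourier_neg, neg_neg]

theorem continuous_fourierInv {f : ℝ → ℂ} (hf : Integrable f) : Continuous (𝓕⁻ f) := by
  rw [Real.fourierInv_eq_fourier_comp_neg]
  exact continuous_fourier hf.comp_neg

theorem fourierInv_toLp_ae_eq {m : ℝ → ℂ} (h1 : Integrable m) (h2 : MemLp m 2) :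
    ((𝓕⁻ (h2.toLp m) : L2C) : ℝ → ℂ) =ᵐ[volume] 𝓕⁻ m := by
  refine ae_eq_of_integral_contDiff_smul_eq (μ := volume)
    ((Lp.memLp _).locallyIntegrable (by norm_num))
    (continuous_fourierInv h1).locallyIntegrable ?_
  intro φ φ_smooth φ_cpt
  have c1 : HasCompactSupport (Complex.ofRealCLM ∘ φ) := φ_cpt.comp_left rfl
  have c2 : ContDiff ℝ (⊤ : ℕ∞) (Complex.ofRealCLM ∘ φ) := by fun_prop
  have h3 := integral_fourierInv_schwartz_mul (c1.toSchwartzMap c2) (h2.toLp m)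
  rw [integral_congr_ae (g := fun x => 𝓕⁻ (c1.toSchwartzMap c2 : ℝ → ℂ) x * m x),
    integral_fourierInv_mul_flip (c1.toSchwartzMap c2).integrable h1] at h3
  · simpa using h3.symm
  · filter_upwards [h2.coeFn_toLp] with x hx
    rw [hx]

theorem locallyIntegrable_comp_L2 (f : L2C) {e : ℝ → ℝ} (he : MeasurePreserving e) :
    LocallyIntegrable fun x => f (e x) :=
  ((Lp.memLp f).comp_measurePreserving he).locallyIntegrable (by norm_num)

theorem fourier_conj_comp_neg (m : ℝ → ℂ) (x : ℝ) :
    𝓕 (fun y => starRingEnd ℂ (m (-y))) x = starRingEnd ℂ (𝓕 m x) := by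
  rw [Real.fourier_real_eq_integral_exp_smul, Real.fourier_real_eq_integral_exp_smul,
    ← integral_conj, ← integral_neg_eq_self]
  refine integral_congr_ae (Eventually.of_forall fun y => ?_)
  simp only [smul_eq_mul, map_mul, neg_neg, ← Complex.exp_conj, Complex.conj_ofReal,
    Complex.conj_I]
  congr 2
  push_cast
  ring

theorem fourier_conj {f h : L2C} (hfh : (h : ℝ → ℂ) =ᵐ[volume] fun x => starRingEnd ℂ (f x)) :
    ((𝓕 h : L2C) : ℝ → ℂ) =ᵐ[volume] fun ξ => starRingEnd ℂ ((𝓕 f : L2C) (-ξ)) := by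
  have hneg : MeasurePreserving (fun x : ℝ => -x) := Measure.measurePreserving_neg _
  refine fourier_ae_eq_of_dual ?_ fun m h1 h2 => ?_
  · have := ((Lp.memLp (𝓕 f)).comp_measurePreserving hneg)
    exact (this.star).locallyIntegrable (by norm_num)
  · have h1' : Integrable (fun y => starRingEnd ℂ (m (-y))) :=
      (Complex.conjCLE.integrable_comp_iff (φ := fun y => m (-y))).mpr h1.comp_neg
    have h2' : MemLp (fun y => starRingEnd ℂ (m (-y))) 2 :=
      (h2.comp_measurePreserving hneg).star
    have key := congrArg (starRingEnd ℂ) (integral_fourier_mul h1' h2' f)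
    rw [← integral_conj, ← integral_conj] at key
    simp only [map_mul, fourier_conj_comp_neg, Complex.conj_conj] at key
    rw [← integral_neg_eq_self (fun x => m x * _)]
    simp only [neg_neg]
    rw [← key]
    refine integral_congr_ae ?_
    filter_upwards [hfh] with x hx
    rw [hx]

/-- The additive character `e^{2iπxy}` is continuous in `y`. -/
theorem continuous_fourierChar_mul (x : ℝ) :
    Continuous fun y : ℝ => (Real.fourierChar (y * x) : ℂ) :=
  Continuous.comp (g := ((↑) : Circle → ℂ)) (by fun_prop) (Real.continuous_fourierChar.comp (by fun_prop))

/-- Modulation becomes translation. -/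
theorem fourier_modulation {f h : L2C} (ξ₀ : ℝ)
    (hfh : (h : ℝ → ℂ) =ᵐ[volume] fun x => (Real.fourierChar (-(x * ξ₀)) : ℂ) * f x) :
    ((𝓕 h : L2C) : ℝ → ℂ) =ᵐ[volume] fun ξ => (𝓕 f : L2C) (ξ + ξ₀) := by
  refine fourier_ae_eq_of_dual
    (locallyIntegrable_comp_L2 _ (measurePreserving_add_right volume ξ₀)) fun m h1 h2 => ?_
  have e1 : ∫ x, m x * (𝓕 f : L2C) (x + ξ₀) = ∫ x, m (x - ξ₀) * (𝓕 f : L2C) x := by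
    rw [← integral_add_right_eq_self (fun x => m (x - ξ₀) * (𝓕 f : L2C) x) ξ₀]
    simp
  rw [e1, ← integral_fourier_mul (h1.comp_sub_right ξ₀)
    (h2.comp_measurePreserving (measurePreserving_sub_right volume ξ₀))]
  refine integral_congr_ae ?_
  filter_upwards [hfh] with x hx
  have : 𝓕 (fun y => m (y - ξ₀)) x = Real.fourierChar (-(x * ξ₀)) * 𝓕 m x := by
    rw [Real.fourier_real_eq, Real.fourier_real_eq, ← integral_const_mul,
      ← integral_add_right_eq_self _ ξ₀]
    refine integral_congr_ae (Eventually.of_forall fun y => ?_)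
    simp only [add_sub_cancel_right, Circle.smul_def, smul_eq_mul, ← mul_assoc]
    rw [← Circle.coe_mul, ← AddChar.map_add_eq_mul]
    congr 3
    ring
  rw [this, hx]
  ring

/-! ### Real functions and Hermitian symmetry. -/

theorem coeFn_toComplex (f : L2R) :
    (toComplex f : ℝ → ℂ) =ᵐ[volume] fun x => (f x : ℂ) :=
  Complex.ofRealCLM.coeFn_compLp f

theorem fourierL2_neg_eq_conj (f : L2R) :
    ∀ᵐ ξ : ℝ, fourierL2 f (-ξ) = starRingEnd ℂ (fourierL2 f ξ) := by
  have h : (toComplex f : ℝ → ℂ) =ᵐ[volume] fun x => starRingEnd ℂ (toComplex f x) := by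
    filter_upwards [coeFn_toComplex f] with x hx
    rw [hx, Complex.conj_ofReal]
  filter_upwards [fourier_conj h] with ξ hξ
  rw [fourierL2, hξ, Complex.conj_conj]

/-- The real part of the inverse Fourier transform. -/
def reFourierInv (G : L2C) : L2R := Complex.reCLM.compLp (𝓕⁻ G : L2C)

/-- Hermitian symmetry makes the inverse transform equal to its own conjugate, so taking the real
part loses nothing. -/
theorem fourierL2_reFourierInv {G : L2C}
    (hG : ∀ᵐ ξ : ℝ, G (-ξ) = starRingEnd ℂ (G ξ)) : fourierL2 (reFourierInv G) = G := by
  set F : L2C := 𝓕⁻ G with hF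
  set F' : L2C := (Lp.memLp F).star.toLp with hF'
  have e1 : (F' : ℝ → ℂ) =ᵐ[volume] fun x => starRingEnd ℂ (F x) := (Lp.memLp F).star.coeFn_toLp
  have e2 : (𝓕 F : L2C) = G := FourierTransform.fourier_fourierInv_eq G
  have e3 : (𝓕 F' : L2C) = G := by
    refine Lp.ext ?_
    filter_upwards [fourier_conj e1, hG] with ξ h1 h2
    rw [h1, e2, h2, Complex.conj_conj]
  have e4 : F' = F := by
    rw [← FourierTransform.fourierInv_fourier_eq (F := L2C) F', e3]
  rw [e4] at e1
  have e5 : toComplex (reFourierInv G) = F := by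
    refine Lp.ext ?_
    filter_upwards [coeFn_toComplex (reFourierInv G), e1, Complex.reCLM.coeFn_compLp F]
      with x h1 h2 h3
    rw [h1, reFourierInv, h3, Complex.reCLM_apply]
    exact Complex.conj_eq_iff_re.mp h2.symm
  rw [fourierL2, e5, e2]

theorem memLp_ofReal (f : L2R) : MemLp (fun x => (f x : ℂ)) 2 (volume : Measure ℝ) :=
  (Lp.memLp f).ofReal

/-! ### Products and convolutions on the Fourier side. -/

/-- The Fourier transform of the product of two real `L²` functions. -/
def fourierMul (f h : L2R) : ℝ → ℂ := 𝓕 (fun x => ((f x * h x : ℝ) : ℂ))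

/-- This is Parseval for `f` and the modulation of `h` by e^{-2iπxξ}, whose transform is a
translate. The correlation form serves both the weighted estimates and the orthogonality of the
flux. -/
theorem fourierMul_eq_integral (f h : L2R) (ξ : ℝ) :
    fourierMul f h ξ = ∫ η, starRingEnd ℂ (fourierL2 f η) * fourierL2 h (η + ξ) := by
  have hm : MemLp (fun x => (Real.fourierChar (-(x * ξ)) : ℂ) * toComplex h x) 2
      (volume : Measure ℝ) := by
    refine (Lp.memLp (toComplex h)).of_le_mul (c := 1) ?_ (Eventually.of_forall fun x => ?_)
    · refine AEStronglyMeasurable.mul (Continuous.aestronglyMeasurable ?_)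
        (Lp.aestronglyMeasurable _)
      simpa using continuous_fourierChar_mul (-ξ)
    · simp [Circle.norm_coe]
  have h1 := Lp.inner_fourier_eq (toComplex f) hm.toLp
  rw [L2.inner_def, L2.inner_def] at h1
  simp only [RCLike.inner_apply] at h1
  have h2 : fourierMul f h ξ = ∫ x, hm.toLp _ x * starRingEnd ℂ (toComplex f x) := by
    rw [fourierMul, Real.fourier_real_eq]
    refine integral_congr_ae ?_
    filter_upwards [hm.coeFn_toLp, coeFn_toComplex f, coeFn_toComplex h] with x e1 e2 e3
    rw [e1, e2, e3, Complex.conj_ofReal, Circle.smul_def, smul_eq_mul]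
    push_cast
    ring
  rw [h2, ← h1]
  refine integral_congr_ae ?_
  filter_upwards [fourier_modulation ξ hm.coeFn_toLp] with η e1
  rw [e1, mul_comm]
  rfl

/-- Convolution with the inverse Fourier transform of an `L¹ ∩ L²` multiplier. -/
theorem conv_fourierInv_L2 {m : ℝ → ℂ} (h1 : Integrable m) (h2 : MemLp m 2) (f : L2R) (x : ℝ) :
    conv (𝓕⁻ m) f x = 𝓕⁻ (fun ξ => m ξ * fourierL2 f ξ) x := by
  have c := continuous_fourierChar_mul x
  have h1' : Integrable (fun ξ => (Real.fourierChar (ξ * x) : ℂ) * m ξ) :=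
    h1.bdd_mul (c := 1) c.aestronglyMeasurable (by simp [Circle.norm_coe])
  have h2' : MemLp (fun ξ => (Real.fourierChar (ξ * x) : ℂ) * m ξ) 2 :=
    h2.of_le_mul (c := 1) (c.aestronglyMeasurable.mul h2.1) (by simp [Circle.norm_coe])
  have key := integral_fourier_mul h1' h2' (toComplex f)
  rw [conv, convolution_eq_swap, Real.fourierInv_eq]
  refine Eq.trans ?_ (key.trans ?_)
  · refine integral_congr_ae ?_
    filter_upwards [coeFn_toComplex f] with y hy
    rw [hy, ContinuousLinearMap.mul_apply']
    congr 1
    rw [Real.fourierInv_eq, Real.fourier_real_eq]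
    refine integral_congr_ae (Eventually.of_forall fun ξ => ?_)
    simp only [Circle.smul_def, smul_eq_mul, ← mul_assoc]
    rw [← Circle.coe_mul, ← AddChar.map_add_eq_mul]
    congr 3
    simp
    ring
  · refine integral_congr_ae (Eventually.of_forall fun ξ => ?_)
    simp only [Circle.smul_def, smul_eq_mul, ← mul_assoc]
    congr 4
    simp [mul_comm]

/-- Convolution with the inverse Fourier transform of an `L¹` multiplier. -/
theorem conv_fourierInv_L1 {m : ℝ → ℂ} (h1 : Integrable m) {f : ℝ → ℝ} (hf : Integrable f)
    (x : ℝ) :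
    conv (𝓕⁻ m) f x = 𝓕⁻ (fun ξ => m ξ * 𝓕 (fun y => (f y : ℂ)) ξ) x := by
  have c := continuous_fourierChar_mul x
  have h1' : Integrable (fun ξ => (Real.fourierChar (ξ * x) : ℂ) * m ξ) :=
    h1.bdd_mul (c := 1) c.aestronglyMeasurable (by simp [Circle.norm_coe])
  have key := integral_fourier_mul_flip h1' (hf.ofReal (𝕜 := ℂ))
  rw [conv, convolution_eq_swap, Real.fourierInv_eq]
  refine Eq.trans ?_ (key.trans ?_)
  · refine integral_congr_ae (Eventually.of_forall fun y => ?_)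
    simp only [ContinuousLinearMap.mul_apply']
    congr 1
    rw [Real.fourierInv_eq, Real.fourier_real_eq]
    refine integral_congr_ae (Eventually.of_forall fun ξ => ?_)
    simp only [Circle.smul_def, smul_eq_mul, ← mul_assoc]
    rw [← Circle.coe_mul, ← AddChar.map_add_eq_mul]
    congr 3
    simp
    ring
  · refine integral_congr_ae (Eventually.of_forall fun ξ => ?_)
    simp only [Circle.smul_def, smul_eq_mul, ← mul_assoc]
    congr 4
    simp [mul_comm]

/-! ### L² norms of functions and linearity of the transform. -/

/-- The `L²` norm of a square integrable function. -/
def n2 (f : ℝ → ℂ) : ℝ := Real.sqrt (∫ ξ, ‖f ξ‖ ^ 2)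

theorem n2_nonneg (f : ℝ → ℂ) : 0 ≤ n2 f := Real.sqrt_nonneg _

theorem n2_congr {f g : ℝ → ℂ} (h : f =ᵐ[volume] g) : n2 f = n2 g := by
  unfold n2
  congr 1
  exact integral_congr_ae (h.mono fun x hx => by simp only [hx])

theorem n2_coe (f : L2C) : n2 f = ‖f‖ := by
  have h := L2.inner_def (𝕜 := ℂ) f f
  rw [inner_self_eq_norm_sq_to_K] at h
  have h2 : ∀ x, inner ℂ (f x) (f x) = ((‖f x‖ ^ 2 : ℝ) : ℂ) := fun x => by
    rw [inner_self_eq_norm_sq_to_K]; norm_cast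
  simp_rw [h2] at h
  rw [integral_complex_ofReal] at h
  have h3 : ‖f‖ ^ 2 = ∫ x, ‖f x‖ ^ 2 := by
    apply Complex.ofReal_injective
    rw [← h, Complex.ofReal_pow]
    rfl
  rw [n2, ← h3, Real.sqrt_sq (norm_nonneg _)]

theorem n2_eq_norm_toLp {f : ℝ → ℂ} (hf : MemLp f 2) : n2 f = ‖hf.toLp f‖ := by
  rw [← n2_coe, n2_congr hf.coeFn_toLp]

theorem n2_sq (f : ℝ → ℂ) : n2 f ^ 2 = ∫ ξ, ‖f ξ‖ ^ 2 :=
  Real.sq_sqrt (integral_nonneg fun _ => by positivity)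

theorem n2_mono {f g : ℝ → ℂ} (hg : MemLp g 2) (h : ∀ᵐ x, ‖f x‖ ≤ ‖g x‖) : n2 f ≤ n2 g := by
  refine Real.sqrt_le_sqrt (integral_mono_of_nonneg (Eventually.of_forall fun _ => by positivity)
    ((memLp_two_iff_integrable_sq_norm hg.1).mp hg) ?_)
  filter_upwards [h] with x hx
  gcongr

theorem n2_add_le {f g : ℝ → ℂ} (hf : MemLp f 2) (hg : MemLp g 2) :
    n2 (fun x => f x + g x) ≤ n2 f + n2 g := by
  have := norm_add_le (hf.toLp f) (hg.toLp g)
  rw [← MemLp.toLp_add, ← n2_eq_norm_toLp, ← n2_eq_norm_toLp, ← n2_eq_norm_toLp] at this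
  exact this

theorem integral_norm_mul_le {f g : ℝ → ℂ} (hf : MemLp f 2) (hg : MemLp g 2) :
    ∫ x, ‖f x‖ * ‖g x‖ ≤ n2 f * n2 g := by
  have := integral_mul_norm_le_Lp_mul_Lq (μ := volume) (f := f) (g := g)
    Real.HolderConjugate.two_two (by simpa using hf) (by simpa using hg)
  refine this.trans_eq ?_
  simp [n2, Real.sqrt_eq_rpow]

theorem integrable_norm_mul {f g : ℝ → ℂ} (hf : MemLp f 2) (hg : MemLp g 2) :
    Integrable fun x => ‖f x‖ * ‖g x‖ := by
  simpa using (integrable_mul_L2 hf hg).norm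

theorem norm_toComplex (f : L2R) : ‖toComplex f‖ = ‖f‖ := by
  rw [Lp.norm_def, Lp.norm_def]
  congr 1
  refine eLpNorm_congr_norm_ae ?_
  filter_upwards [coeFn_toComplex f] with x hx
  rw [hx, Complex.norm_real]

theorem norm_fourierL2 (f : L2R) : ‖fourierL2 f‖ = ‖f‖ := by
  rw [fourierL2, Lp.norm_fourier_eq, norm_toComplex]

theorem n2_fourierL2 (f : L2R) : n2 (fourierL2 f) = ‖f‖ := by
  rw [n2_coe, norm_fourierL2]

theorem toComplex_eq (f : L2R) : toComplex f = Complex.ofRealCLM.compLpL 2 volume f := rfl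

theorem fourierL2_add (f g : L2R) : fourierL2 (f + g) = fourierL2 f + fourierL2 g := by
  rw [fourierL2, toComplex_eq, map_add, FourierTransform.fourier_add]
  rfl

theorem fourierL2_smul (c : ℝ) (f : L2R) : fourierL2 (c • f) = (c : ℂ) • fourierL2 f := by
  have h : toComplex (c • f) = (c : ℂ) • toComplex f := by
    refine Lp.ext ?_
    filter_upwards [coeFn_toComplex (c • f), Lp.coeFn_smul c f,
      Lp.coeFn_smul (c : ℂ) (toComplex f), coeFn_toComplex f] with x h1 h2 h3 h4
    rw [h1, h2, h3]
    simp [h4]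
  rw [fourierL2, h, FourierTransform.fourier_smul]
  rfl

theorem fourierL2_sub (f g : L2R) : fourierL2 (f - g) = fourierL2 f - fourierL2 g := by
  have := fourierL2_add (f - g) g
  rw [sub_add_cancel] at this
  rw [this, add_sub_cancel_right]

theorem fourierL2_injective : Function.Injective fourierL2 := fun f g h => by
  rw [← sub_eq_zero, ← norm_eq_zero, ← norm_fourierL2, fourierL2_sub, h, sub_self, norm_zero]

theorem norm_reFourierInv_sub_le (G H : L2C) :
    ‖reFourierInv G - reFourierInv H‖ ≤ ‖G - H‖ := by
  have e : reFourierInv G - reFourierInv H = Complex.reCLM.compLp (𝓕⁻ (G - H) : L2C) := by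
    have h1 : (𝓕⁻ (G - H) : L2C) = 𝓕⁻ G - 𝓕⁻ H := (Lp.fourierTransformₗᵢ ℝ ℂ).symm.map_sub G H
    rw [h1]
    exact ((Complex.reCLM.compLpL 2 volume).map_sub _ _).symm
  have h2 : ‖(𝓕⁻ (G - H) : L2C)‖ = ‖G - H‖ := (Lp.fourierTransformₗᵢ ℝ ℂ).symm.norm_map _
  rw [e, ← h2]
  refine Lp.norm_le_norm_of_ae_le ?_
  filter_upwards [Complex.reCLM.coeFn_compLp (𝓕⁻ (G - H) : L2C)] with x hx
  rw [hx]
  exact Complex.abs_re_le_norm _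

/-! ### The symbol and the Duhamel integral at a fixed frequency. -/

theorem continuous_psi (a b : ℝ) : Continuous (psi a b) := by
  unfold psi
  have h1 : Continuous fun ξ : ℝ => |ξ| ^ (4 / 3 : ℝ) :=
    continuous_abs.rpow_const fun _ => Or.inr (by norm_num)
  have h2 : Continuous fun ξ : ℝ => |ξ| ^ (1 / 3 : ℝ) :=
    continuous_abs.rpow_const fun _ => Or.inr (by norm_num)
  fun_prop

theorem psi_neg (a b ξ : ℝ) : psi a b (-ξ) = starRingEnd ℂ (psi a b ξ) := by
  simp only [psi, map_add, map_mul, Complex.conj_ofReal, Complex.conj_I, abs_neg]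
  push_cast
  ring

theorem psi_re (a b ξ : ℝ) :
    (psi a b ξ).re = 4 * Real.pi ^ 2 * ξ ^ 2 - a * |ξ| ^ (4 / 3 : ℝ) := by
  rw [psi, Complex.add_re, Complex.ofReal_re, Complex.mul_re, Complex.ofReal_re, Complex.ofReal_im]
  simp

/-- The antidiffusive term is of lower order than the diffusion, so it costs only a constant. That
constant `a ^ 3` enters the exponential rates below. -/
theorem le_psi_re {a : ℝ} (ha : 0 < a) (b ξ : ℝ) : ξ ^ 2 - a ^ 3 ≤ (psi a b ξ).re := by
  rw [psi_re]
  have hpi : 2 ≤ 4 * Real.pi ^ 2 := by nlinarith [Real.pi_gt_three]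
  have key : a * |ξ| ^ (4 / 3 : ℝ) ≤ ξ ^ 2 + a ^ 3 := by
    -- In terms of y the claim is a y⁴ ≤ y⁶ + a³. One of the two right-hand terms suffices,
    -- according to whether a ≤ y² or not.
    set y := |ξ| ^ (1 / 3 : ℝ) with hy
    have hy0 : 0 ≤ y := by positivity
    have h4 : |ξ| ^ (4 / 3 : ℝ) = y ^ 4 := by
      rw [hy, ← Real.rpow_natCast, ← Real.rpow_mul (abs_nonneg _)]; norm_num
    have h6 : ξ ^ 2 = y ^ 6 := by
      rw [hy, ← Real.rpow_natCast (|ξ| ^ (1 / 3 : ℝ)), ← Real.rpow_mul (abs_nonneg _), ← sq_abs,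
        ← Real.rpow_natCast |ξ|]
      norm_num
    rw [h4, h6]
    rcases le_total a (y ^ 2) with h | h
    · nlinarith [mul_le_mul_of_nonneg_right h (by positivity : 0 ≤ y ^ 4), pow_pos ha 3]
    · have : a * y ^ 4 ≤ a * a ^ 2 := by
        have : y ^ 4 ≤ a ^ 2 := by nlinarith [sq_nonneg y]
        gcongr
      nlinarith [pow_nonneg hy0 6]
  nlinarith [sq_nonneg ξ]

theorem norm_exp_psi (a b t ξ : ℝ) :
    ‖Complex.exp (-(t : ℂ) * psi a b ξ)‖ = Real.exp (-t * (psi a b ξ).re) := by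
  rw [Complex.norm_exp]
  simp

theorem norm_exp_psi_le {a : ℝ} (ha : 0 < a) (b : ℝ) {t : ℝ} (ht : 0 ≤ t) (ξ : ℝ) :
    ‖Complex.exp (-(t : ℂ) * psi a b ξ)‖ ≤ Real.exp (a ^ 3 * t) * Real.exp (-t * ξ ^ 2) := by
  rw [norm_exp_psi, ← Real.exp_add]
  refine Real.exp_le_exp.mpr ?_
  nlinarith [mul_le_mul_of_nonneg_left (le_psi_re ha b ξ) ht]

theorem norm_exp_psi_le' {a : ℝ} (ha : 0 < a) (b : ℝ) {t : ℝ} (ht : 0 ≤ t) (ξ : ℝ) :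
    ‖Complex.exp (-(t : ℂ) * psi a b ξ)‖ ≤ Real.exp (a ^ 3 * t) := by
  refine (norm_exp_psi_le ha b ht ξ).trans ?_
  have : Real.exp (-t * ξ ^ 2) ≤ 1 := Real.exp_le_one_iff.mpr (by nlinarith [sq_nonneg ξ])
  nlinarith [Real.exp_pos (a ^ 3 * t)]

/-- The Duhamel integral at one frequency. -/
def duh (a b : ℝ) (g : ℝ → ℝ → ℂ) (t ξ : ℝ) : ℂ :=
  ∫ s in (0 : ℝ)..t, Complex.exp (-((t - s : ℝ) : ℂ) * psi a b ξ) * g s ξ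

/-- The growth of the source against the decay of the propagator leaves A e^{(a³+μ)t}
e^{-(t-s)(ξ²+μ)}, whose time integral gains 1/(ξ²+μ). The majorant is kept, and not only the
resulting bound, because `integrable_duhamel_prod` needs the integral of the norm. -/
theorem exists_duh_majorant {a : ℝ} (ha : 0 < a) (b : ℝ) {g : ℝ → ℝ → ℂ} {t ξ μ A : ℝ}
    (ht : 0 ≤ t) (hμ : 0 < μ)
    (hg : ∀ s ∈ Icc 0 t, ‖g s ξ‖ ≤ A * Real.exp ((a ^ 3 + μ) * s)) :
    ∃ F : ℝ → ℝ, Continuous F ∧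
      (∀ s ∈ Icc 0 t, ‖Complex.exp (-((t - s : ℝ) : ℂ) * psi a b ξ) * g s ξ‖ ≤ F s) ∧
      ∫ s in (0 : ℝ)..t, F s ≤ A * Real.exp ((a ^ 3 + μ) * t) / (ξ ^ 2 + μ) := by
  have hden : 0 < ξ ^ 2 + μ := by positivity
  have hA : 0 ≤ A := by
    have := (norm_nonneg _).trans (hg 0 ⟨le_rfl, ht⟩)
    simpa using this
  set F : ℝ → ℝ := fun s =>
    A * Real.exp ((a ^ 3 + μ) * t) / (ξ ^ 2 + μ) * Real.exp (-(t - s) * (ξ ^ 2 + μ)) with hF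
  set F' : ℝ → ℝ := fun s =>
    A * Real.exp ((a ^ 3 + μ) * t) * Real.exp (-(t - s) * (ξ ^ 2 + μ)) with hF'
  have hder : ∀ s, HasDerivAt F (F' s) s := fun s => by
    have h1 : HasDerivAt (fun s => -(t - s) * (ξ ^ 2 + μ)) (ξ ^ 2 + μ) s := by
      simpa using (((hasDerivAt_id s).const_sub t).neg.mul_const (ξ ^ 2 + μ))
    refine (h1.exp.const_mul (A * Real.exp ((a ^ 3 + μ) * t) / (ξ ^ 2 + μ))).congr_deriv ?_
    simp only [hF']
    field_simp
  have hcont : Continuous F' := by fun_prop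
  have hint := intervalIntegral.integral_eq_sub_of_hasDerivAt (a := 0) (b := t)
    (fun s _ => hder s) (hcont.intervalIntegrable 0 t)
  refine ⟨F', hcont, fun s hs => ?_, ?_⟩
  · rw [norm_mul]
    have h1 := norm_exp_psi_le ha b (t := t - s) (by linarith [hs.2]) ξ
    have h2 := hg s hs
    refine (mul_le_mul h1 h2 (norm_nonneg _) (by positivity)).trans_eq ?_
    simp only [hF']
    rw [show Real.exp (a ^ 3 * (t - s)) * Real.exp (-(t - s) * ξ ^ 2) *
      (A * Real.exp ((a ^ 3 + μ) * s)) = A * (Real.exp (a ^ 3 * (t - s)) *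
        Real.exp (-(t - s) * ξ ^ 2) * Real.exp ((a ^ 3 + μ) * s)) by ring, mul_assoc A,
      ← Real.exp_add, ← Real.exp_add, ← Real.exp_add]
    congr 2
    ring
  · rw [hint]
    simp only [hF, sub_self, neg_zero, zero_mul, Real.exp_zero, mul_one, sub_zero]
    have : 0 ≤ A * Real.exp ((a ^ 3 + μ) * t) / (ξ ^ 2 + μ) * Real.exp (-t * (ξ ^ 2 + μ)) := by
      positivity
    linarith

theorem norm_duh_le {a : ℝ} (ha : 0 < a) (b : ℝ) {g : ℝ → ℝ → ℂ} {t ξ μ A : ℝ} (ht : 0 ≤ t)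
    (hμ : 0 < μ) (hg : ∀ s ∈ Icc 0 t, ‖g s ξ‖ ≤ A * Real.exp ((a ^ 3 + μ) * s)) :
    ‖duh a b g t ξ‖ ≤ A * Real.exp ((a ^ 3 + μ) * t) / (ξ ^ 2 + μ) := by
  obtain ⟨F, hF, hle, hint⟩ := exists_duh_majorant ha b ht hμ hg
  refine le_trans ?_ hint
  exact intervalIntegral.norm_integral_le_of_norm_le ht
    (Eventually.of_forall fun s hs => hle s ⟨hs.1.le, hs.2⟩) (hF.intervalIntegrable 0 t)

theorem continuous_duh (a b : ℝ) {g : ℝ → ℝ → ℂ} (hg : Continuous (Function.uncurry g)) :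
    Continuous (Function.uncurry (duh a b g)) := by
  have := intervalIntegral.continuous_parametric_intervalIntegral_of_continuous (μ := volume)
    (a₀ := 0) (X := ℝ × ℝ) (s := fun p => p.1)
    (f := fun p s => Complex.exp (-((p.1 - s : ℝ) : ℂ) * psi a b p.2) * g s p.2) ?_ continuous_fst
  · exact this
  · have h1 := continuous_psi a b
    have h2 : Continuous fun q : (ℝ × ℝ) × ℝ => g q.2 q.1.2 :=
      hg.comp (continuous_snd.prodMk (continuous_snd.comp continuous_fst))
    simp only [Function.uncurry_def]
    fun_prop

theorem duh_sub (a b : ℝ) {g h : ℝ → ℝ → ℂ} (hg : Continuous (Function.uncurry g))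
    (hh : Continuous (Function.uncurry h)) (t ξ : ℝ) :
    duh a b g t ξ - duh a b h t ξ = duh a b (fun s ξ => g s ξ - h s ξ) t ξ := by
  have h2 : Continuous fun s => g s ξ := hg.comp (continuous_id.prodMk continuous_const)
  have h3 : Continuous fun s => h s ξ := hh.comp (continuous_id.prodMk continuous_const)
  simp only [duh, mul_sub]
  rw [← intervalIntegral.integral_sub] <;> exact Continuous.intervalIntegrable (by fun_prop) _ _

theorem duh_congr (a b : ℝ) {g h : ℝ → ℝ → ℂ} {t ξ : ℝ} (ht : 0 ≤ t)
    (H : ∀ s ∈ Icc 0 t, g s ξ = h s ξ) : duh a b g t ξ = duh a b h t ξ := by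
  refine intervalIntegral.integral_congr fun s hs => ?_
  rw [uIcc_of_le ht] at hs
  simp only [H s hs]

theorem duh_neg (a b : ℝ) {g : ℝ → ℝ → ℂ} (hg : ∀ s ξ, g s (-ξ) = starRingEnd ℂ (g s ξ))
    (t ξ : ℝ) : duh a b g t (-ξ) = starRingEnd ℂ (duh a b g t ξ) := by
  rw [duh, duh, intervalIntegral.intervalIntegral_eq_integral_uIoc,
    intervalIntegral.intervalIntegral_eq_integral_uIoc, Complex.real_smul, Complex.real_smul,
    map_mul, ← integral_conj, Complex.conj_ofReal]
  congr 1
  refine integral_congr_ae (Eventually.of_forall fun s => ?_)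
  simp only [psi_neg, hg, map_mul, ← Complex.exp_conj, map_neg, Complex.conj_ofReal]

/-- The solution of the linear equation with source `-πiξ g`, at one frequency. -/
def sol (a b : ℝ) (c : ℝ → ℂ) (g : ℝ → ℝ → ℂ) (t ξ : ℝ) : ℂ :=
  Complex.exp (-(t : ℂ) * psi a b ξ) * c ξ - Real.pi * Complex.I * ξ * duh a b g t ξ

theorem sol_zero (a b : ℝ) (c : ℝ → ℂ) (g : ℝ → ℝ → ℂ) (ξ : ℝ) : sol a b c g 0 ξ = c ξ := by
  simp [sol, duh]

theorem hasDerivAt_duh (a b : ℝ) {g : ℝ → ℝ → ℂ} {ξ : ℝ} (hg : Continuous fun s => g s ξ)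
    (t : ℝ) : HasDerivAt (fun t => duh a b g t ξ) (g t ξ - psi a b ξ * duh a b g t ξ) t := by
  -- With e^{-tψ} taken out, the integrand no longer depends on t and the fundamental theorem of
  -- calculus applies.
  have e : ∀ t, duh a b g t ξ = Complex.exp (-(t : ℂ) * psi a b ξ) *
      ∫ s in (0 : ℝ)..t, Complex.exp ((s : ℂ) * psi a b ξ) * g s ξ := fun t => by
    rw [duh, ← intervalIntegral.integral_const_mul]
    refine intervalIntegral.integral_congr fun s _ => ?_
    simp only [← mul_assoc, ← Complex.exp_add]
    congr 2
    push_cast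
    ring
  have h1 : HasDerivAt (fun t : ℝ => Complex.exp (-(t : ℂ) * psi a b ξ))
      (-psi a b ξ * Complex.exp (-(t : ℂ) * psi a b ξ)) t := by
    have h0 : HasDerivAt (fun t : ℝ => -(t : ℂ) * psi a b ξ) (-psi a b ξ) t := by
      simpa using ((Complex.ofRealCLM.hasDerivAt (x := t)).neg.mul_const (psi a b ξ))
    simpa [mul_comm] using h0.cexp
  have hc : Continuous fun s : ℝ => Complex.exp ((s : ℂ) * psi a b ξ) * g s ξ := by fun_prop
  have h2 := intervalIntegral.integral_hasDerivAt_right (hc.intervalIntegrable 0 t)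
    hc.aestronglyMeasurable.stronglyMeasurableAtFilter hc.continuousAt
  have h3 := h1.mul h2
  have h4 : HasDerivAt (fun t => duh a b g t ξ) _ t :=
    h3.congr_of_eventuallyEq (Eventually.of_forall fun t => e t)
  refine h4.congr_deriv ?_
  rw [e t]
  have : Complex.exp (-(t : ℂ) * psi a b ξ) * Complex.exp ((t : ℂ) * psi a b ξ) = 1 := by
    rw [← Complex.exp_add]; simp
  linear_combination (g t ξ) * this

theorem hasDerivAt_sol (a b : ℝ) (c : ℝ → ℂ) {g : ℝ → ℝ → ℂ} {ξ : ℝ}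
    (hg : Continuous fun s => g s ξ) (t : ℝ) :
    HasDerivAt (fun t => sol a b c g t ξ)
      (-psi a b ξ * sol a b c g t ξ - Real.pi * Complex.I * ξ * g t ξ) t := by
  have h1 : HasDerivAt (fun t : ℝ => Complex.exp (-(t : ℂ) * psi a b ξ))
      (-psi a b ξ * Complex.exp (-(t : ℂ) * psi a b ξ)) t := by
    have h0 : HasDerivAt (fun t : ℝ => -(t : ℂ) * psi a b ξ) (-psi a b ξ) t := by
      simpa using ((Complex.ofRealCLM.hasDerivAt (x := t)).neg.mul_const (psi a b ξ))
    simpa [mul_comm] using h0.cexp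
  have h2 := (h1.mul_const (c ξ)).sub
    ((hasDerivAt_duh a b hg t).const_mul (Real.pi * Complex.I * ξ : ℂ))
  refine h2.congr_deriv ?_
  simp only [sol]
  ring

/-! ### The smoothing profile. -/

/-- The function `(ξ² + μ)^{-1/2}`. -/
def kf (μ ξ : ℝ) : ℝ := (Real.sqrt (ξ ^ 2 + μ))⁻¹

theorem kf_nonneg (μ ξ : ℝ) : 0 ≤ kf μ ξ := by unfold kf; positivity

theorem continuous_kf {μ : ℝ} (hμ : 0 < μ) : Continuous (kf μ) := by
  unfold kf
  refine Continuous.inv₀ (by fun_prop) fun ξ => ?_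
  positivity

theorem kf_sq {μ : ℝ} (hμ : 0 < μ) (ξ : ℝ) :
    ‖((kf μ ξ : ℝ) : ℂ)‖ ^ 2 = μ⁻¹ * (1 + (ξ / Real.sqrt μ) ^ 2)⁻¹ := by
  rw [Complex.norm_real, Real.norm_of_nonneg (kf_nonneg _ _), kf, inv_pow,
    Real.sq_sqrt (by positivity), div_pow, Real.sq_sqrt hμ.le, ← mul_inv]
  congr 1
  field_simp
  ring

theorem memLp_kf {μ : ℝ} (hμ : 0 < μ) : MemLp (fun ξ => ((kf μ ξ : ℝ) : ℂ)) 2 := by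
  have hc : Continuous fun ξ => ((kf μ ξ : ℝ) : ℂ) :=
    Complex.continuous_ofReal.comp (continuous_kf hμ)
  rw [memLp_two_iff_integrable_sq_norm hc.aestronglyMeasurable]
  simp_rw [kf_sq hμ]
  exact (integrable_inv_one_add_sq.comp_div (Real.sqrt_ne_zero'.mpr hμ)).const_mul _

/-- The decay in the rate is what produces a contraction. Writing the rate as a fourth power avoids
fractional exponents. -/
theorem n2_kf {ν : ℝ} (hν : 0 < ν) :
    n2 (fun ξ => ((kf (ν ^ 4) ξ : ℝ) : ℂ)) = Real.sqrt Real.pi / ν := by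
  have h4 : Real.sqrt (ν ^ 4) = ν ^ 2 := by
    rw [show ν ^ 4 = (ν ^ 2) ^ 2 by ring, Real.sqrt_sq (by positivity)]
  rw [n2]
  simp_rw [kf_sq (pow_pos hν 4)]
  rw [integral_const_mul, Measure.integral_comp_div (fun x : ℝ => (1 + x ^ 2)⁻¹),
    integral_univ_inv_one_add_sq, h4, abs_of_pos (by positivity), smul_eq_mul,
    show (ν ^ 4)⁻¹ * (ν ^ 2 * Real.pi) = Real.pi / ν ^ 2 by field_simp,
    Real.sqrt_div Real.pi_pos.le, Real.sqrt_sq hν.le]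

/-- The time integral gains two powers of the frequency and the derivative in the flux costs one;
the remaining power is enough for square integrability in one dimension. -/
theorem abs_div_le_kf {μ : ℝ} (hμ : 0 < μ) (ξ : ℝ) : |ξ| / (ξ ^ 2 + μ) ≤ kf μ ξ := by
  have h : 0 < ξ ^ 2 + μ := by positivity
  have h1 : |ξ| ≤ Real.sqrt (ξ ^ 2 + μ) := by
    rw [← Real.sqrt_sq_eq_abs]
    exact Real.sqrt_le_sqrt (by linarith)
  rw [kf, div_le_iff₀ h]
  have h2 : ξ ^ 2 + μ = Real.sqrt (ξ ^ 2 + μ) * Real.sqrt (ξ ^ 2 + μ) :=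
    (Real.mul_self_sqrt h.le).symm
  have h3 : 0 < Real.sqrt (ξ ^ 2 + μ) := Real.sqrt_pos.mpr h
  calc |ξ| ≤ Real.sqrt (ξ ^ 2 + μ) := h1
    _ = (Real.sqrt (ξ ^ 2 + μ))⁻¹ * (Real.sqrt (ξ ^ 2 + μ) * Real.sqrt (ξ ^ 2 + μ)) := by
      field_simp
    _ = _ := by rw [← h2]

/-- The pointwise bound for the Duhamel term. -/
theorem norm_duhamel_le {a : ℝ} (ha : 0 < a) (b : ℝ) {g : ℝ → ℝ → ℂ} {t ξ μ A : ℝ} (ht : 0 ≤ t)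
    (hμ : 0 < μ) (hg : ∀ s ∈ Icc 0 t, ‖g s ξ‖ ≤ A * Real.exp ((a ^ 3 + μ) * s)) :
    ‖(Real.pi * Complex.I * ξ : ℂ) * duh a b g t ξ‖ ≤
      Real.pi * A * Real.exp ((a ^ 3 + μ) * t) * kf μ ξ := by
  have hA : 0 ≤ A := by
    have := (norm_nonneg _).trans (hg 0 ⟨le_rfl, ht⟩)
    simpa using this
  have h1 := norm_duh_le ha b ht hμ hg
  have h2 := abs_div_le_kf hμ ξ
  rw [norm_mul, norm_mul, norm_mul, Complex.norm_I, Complex.norm_real, Complex.norm_real,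
    Real.norm_of_nonneg Real.pi_pos.le, Real.norm_eq_abs, mul_one]
  calc Real.pi * |ξ| * ‖duh a b g t ξ‖
      ≤ Real.pi * |ξ| * (A * Real.exp ((a ^ 3 + μ) * t) / (ξ ^ 2 + μ)) := by gcongr
    _ = Real.pi * A * Real.exp ((a ^ 3 + μ) * t) * (|ξ| / (ξ ^ 2 + μ)) := by ring
    _ ≤ _ := by gcongr

/-! ### Sup bounds for the quadratic term. -/

theorem integrable_mul_real (f h : L2R) : Integrable (fun x => f x * h x) :=
  (Lp.memLp f).integrable_mul (Lp.memLp h)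

theorem n2_ofReal (f : L2R) : n2 (fun x => (f x : ℂ)) = ‖f‖ := by
  rw [← norm_toComplex, ← n2_coe]
  exact (n2_congr (coeFn_toComplex f)).symm

theorem norm_fourierMul_le (f h : L2R) (ξ : ℝ) : ‖fourierMul f h ξ‖ ≤ ‖f‖ * ‖h‖ := by
  refine (VectorFourier.norm_fourierIntegral_le_integral_norm _ _ _ _ _).trans ?_
  have := integral_norm_mul_le (memLp_ofReal f) (memLp_ofReal h)
  rw [n2_ofReal, n2_ofReal] at this
  refine le_trans (le_of_eq ?_) this
  simp

theorem continuous_fourierMul (f h : L2R) : Continuous (fourierMul f h) :=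
  continuous_fourier (integrable_mul_real f h).ofReal

theorem integrable_fourierChar_smul {f : ℝ → ℂ} (hf : Integrable f) (ξ : ℝ) :
    Integrable fun x => Real.fourierChar (-(x * ξ)) • f x := by
  refine (hf.bdd_mul (c := 1) (continuous_fourierChar_mul (-ξ)).aestronglyMeasurable
    (by simp [Circle.norm_coe])).congr (Eventually.of_forall fun x => ?_)
  simp [Circle.smul_def]

/-- From f² - h² = (f - h)(f + h); this makes the quadratic term Lipschitz on bounded sets. -/
theorem fourierMul_self_sub (f h : L2R) (ξ : ℝ) :
    fourierMul f f ξ - fourierMul h h ξ = fourierMul (f - h) (f + h) ξ := by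
  have e : (fun x => (((f - h : L2R) x * (f + h : L2R) x : ℝ) : ℂ)) =ᵐ[volume]
      (fun x => ((f x * f x : ℝ) : ℂ) - ((h x * h x : ℝ) : ℂ)) := by
    filter_upwards [Lp.coeFn_sub f h, Lp.coeFn_add f h] with x h1 h2
    rw [h1, h2, Pi.sub_apply, Pi.add_apply]
    push_cast
    ring
  rw [fourierMul, fourierMul, fourierMul, Real.fourier_congr_ae e, Real.fourier_real_eq,
    Real.fourier_real_eq, Real.fourier_real_eq, ← integral_sub]
  · simp only [smul_sub]
  · exact integrable_fourierChar_smul (integrable_mul_real f f).ofReal ξ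
  · exact integrable_fourierChar_smul (integrable_mul_real h h).ofReal ξ

theorem norm_fourierMul_self_sub_le (f h : L2R) (ξ : ℝ) :
    ‖fourierMul f f ξ - fourierMul h h ξ‖ ≤ ‖f - h‖ * ‖f + h‖ := by
  rw [fourierMul_self_sub]
  exact norm_fourierMul_le _ _ _

theorem fourierMul_neg (f h : L2R) (ξ : ℝ) :
    fourierMul f h (-ξ) = starRingEnd ℂ (fourierMul f h ξ) := by
  rw [fourierMul, Real.fourier_real_eq_integral_exp_smul, Real.fourier_real_eq_integral_exp_smul,
    ← integral_conj]
  refine integral_congr_ae (Eventually.of_forall fun y => ?_)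
  simp only [smul_eq_mul, map_mul, ← Complex.exp_conj, Complex.conj_ofReal, Complex.conj_I]
  congr 2
  push_cast
  ring

theorem continuous_fourierMul_self :
    Continuous fun p : L2R × ℝ => fourierMul p.1 p.1 p.2 := by
  rw [continuous_iff_continuousAt]
  rintro ⟨f₀, ξ₀⟩
  rw [ContinuousAt, tendsto_iff_norm_sub_tendsto_zero]
  have h1 : Tendsto (fun p : L2R × ℝ => ‖p.1 - f₀‖ * ‖p.1 + f₀‖ +
      ‖fourierMul f₀ f₀ p.2 - fourierMul f₀ f₀ ξ₀‖) (𝓝 (f₀, ξ₀)) (𝓝 0) := by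
    have hc : Continuous fun p : L2R × ℝ => ‖p.1 - f₀‖ * ‖p.1 + f₀‖ +
        ‖fourierMul f₀ f₀ p.2 - fourierMul f₀ f₀ ξ₀‖ := by
      have := continuous_fourierMul f₀ f₀
      fun_prop
    simpa using hc.tendsto (f₀, ξ₀)
  refine squeeze_zero (fun _ => norm_nonneg _) (fun p => ?_) h1
  have : fourierMul p.1 p.1 p.2 - fourierMul f₀ f₀ ξ₀ =
      (fourierMul p.1 p.1 p.2 - fourierMul f₀ f₀ p.2) +
        (fourierMul f₀ f₀ p.2 - fourierMul f₀ f₀ ξ₀) := by ring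
  rw [this]
  exact (norm_add_le _ _).trans (by gcongr; exact norm_fourierMul_self_sub_le _ _ _)

/-! ### Weights and the tame estimate. -/

/-- A weight that is subadditive up to a constant. -/
structure IsWeight (c : ℝ) (w : ℝ → ℝ) : Prop where
  continuous : Continuous w
  one_le : ∀ ξ, 1 ≤ w ξ
  le_add : ∀ ξ η, w ξ ≤ c * (w η + w (η + ξ))

theorem IsWeight.nonneg {c : ℝ} {w : ℝ → ℝ} (hw : IsWeight c w) (ξ : ℝ) : 0 ≤ w ξ :=
  zero_le_one.trans (hw.one_le ξ)

theorem IsWeight.const_nonneg {c : ℝ} {w : ℝ → ℝ} (hw : IsWeight c w) : 0 ≤ c := by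
  by_contra! h
  have h1 := hw.le_add 0 0
  have h2 := hw.one_le 0
  simp only [add_zero] at h1
  nlinarith

theorem n2_comp_add_right (f : ℝ → ℂ) (ξ : ℝ) : n2 (fun η => f (η + ξ)) = n2 f := by
  rw [n2, n2, integral_add_right_eq_self (fun η => ‖f η‖ ^ 2)]

/-- A weight falls on one factor of a correlation at a time. -/
theorem IsWeight.mul_integral_le {c : ℝ} {w : ℝ → ℝ} (hw : IsWeight c w) {f : L2R}
    (hf : MemLp (fun ξ => (w ξ : ℂ) * fourierL2 f ξ) 2) (ξ : ℝ) :
    w ξ * ∫ η, ‖fourierL2 f η‖ * ‖fourierL2 f (η + ξ)‖ ≤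
      2 * c * ‖f‖ * n2 (fun ξ => (w ξ : ℂ) * fourierL2 f ξ) := by
  set F := fourierL2 f with hF
  set W : ℝ → ℂ := fun ξ => (w ξ : ℂ) * F ξ with hW
  have hF2 : MemLp F 2 := Lp.memLp F
  have hadd := measurePreserving_add_right (volume : Measure ℝ) ξ
  have hFs : MemLp (fun η => F (η + ξ)) 2 := hF2.comp_measurePreserving hadd
  have hWs : MemLp (fun η => W (η + ξ)) 2 := hf.comp_measurePreserving hadd
  have nW : ∀ η, ‖W η‖ = w η * ‖F η‖ := fun η => by
    rw [hW, norm_mul, Complex.norm_real, Real.norm_of_nonneg (hw.nonneg η)]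
  have i1 := integrable_norm_mul hf hFs
  have i2 := integrable_norm_mul hF2 hWs
  have b1 := integral_norm_mul_le hf hFs
  have b2 := integral_norm_mul_le hF2 hWs
  rw [n2_comp_add_right F ξ, n2_fourierL2] at b1
  rw [n2_comp_add_right W ξ, n2_fourierL2] at b2
  calc w ξ * ∫ η, ‖F η‖ * ‖F (η + ξ)‖
      = ∫ η, w ξ * (‖F η‖ * ‖F (η + ξ)‖) := (integral_const_mul _ _).symm
    _ ≤ ∫ η, c * (‖W η‖ * ‖F (η + ξ)‖ + ‖F η‖ * ‖W (η + ξ)‖) := by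
        refine integral_mono ((integrable_norm_mul hF2 hFs).const_mul _)
          ((i1.add i2).const_mul c) fun η => ?_
        simp only [nW]
        calc w ξ * (‖F η‖ * ‖F (η + ξ)‖)
            ≤ (c * (w η + w (η + ξ))) * (‖F η‖ * ‖F (η + ξ)‖) := by
              gcongr
              exact hw.le_add ξ η
          _ = _ := by ring
    _ = c * ((∫ η, ‖W η‖ * ‖F (η + ξ)‖) + ∫ η, ‖F η‖ * ‖W (η + ξ)‖) := by
        rw [integral_const_mul, integral_add i1 i2]
    _ ≤ c * (n2 W * ‖f‖ + ‖f‖ * n2 W) := by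
        have := hw.const_nonneg
        gcongr
    _ = _ := by ring

/-- The tame estimate for the square of a function. -/
theorem IsWeight.mul_norm_fourierMul_self_le {c : ℝ} {w : ℝ → ℝ} (hw : IsWeight c w) {f : L2R}
    (hf : MemLp (fun ξ => (w ξ : ℂ) * fourierL2 f ξ) 2) (ξ : ℝ) :
    w ξ * ‖fourierMul f f ξ‖ ≤ 2 * c * ‖f‖ * n2 (fun ξ => (w ξ : ℂ) * fourierL2 f ξ) := by
  refine le_trans (mul_le_mul_of_nonneg_left ?_ (hw.nonneg ξ)) (hw.mul_integral_le hf ξ)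
  rw [fourierMul_eq_integral]
  refine (norm_integral_le_integral_norm _).trans_eq ?_
  simp

/-! ### Truncation of the nonlinearity. -/

/-- The radial retraction onto the ball of radius `R`. -/
def retr (R : ℝ) (f : L2R) : L2R := (R / max R ‖f‖) • f

theorem retr_eq_self {R : ℝ} (hR : 0 < R) {f : L2R} (hf : ‖f‖ ≤ R) : retr R f = f := by
  rw [retr, max_eq_left hf, div_self hR.ne', one_smul]

theorem norm_retr_le {R : ℝ} (hR : 0 < R) (f : L2R) : ‖retr R f‖ ≤ R := by
  have hm : 0 < max R ‖f‖ := lt_max_of_lt_left hR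
  rw [retr, norm_smul, Real.norm_of_nonneg (by positivity), div_mul_eq_mul_div, div_le_iff₀ hm]
  gcongr
  exact le_max_right _ _

theorem norm_retr_sub_le {R : ℝ} (hR : 0 < R) (f h : L2R) :
    ‖retr R f - retr R h‖ ≤ 2 * ‖f - h‖ := by
  set p := max R ‖f‖ with hp
  set q := max R ‖h‖ with hq
  have hp0 : 0 < p := lt_max_of_lt_left hR
  have hq0 : 0 < q := lt_max_of_lt_left hR
  -- Each term is at most ‖f - h‖: the first because R/p ≤ 1, the second because |R/p - R/q| ‖h‖ ≤
  -- |q - p|. The factor 2 is not sharp, but any Lipschitz constant would do.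
  have e : retr R f - retr R h = (R / p) • (f - h) + (R / p - R / q) • h := by
    simp only [retr, ← hp, ← hq, smul_sub, sub_smul]
    abel
  have h1 : R / p ≤ 1 := (div_le_one hp0).mpr (le_max_left _ _)
  have h2 : |R / p - R / q| * ‖h‖ ≤ ‖f - h‖ := by
    have e2 : R / p - R / q = (R / p) * ((q - p) / q) := by field_simp
    have h3 : |q - p| ≤ ‖f - h‖ := by
      rw [hp, hq, max_comm R, max_comm R, norm_sub_rev]
      exact (abs_max_sub_max_le_abs _ _ _).trans (abs_norm_sub_norm_le _ _)
    rw [e2, abs_mul, abs_of_nonneg (by positivity : 0 ≤ R / p), abs_div, abs_of_pos hq0]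
    have h4 : ‖h‖ ≤ q := le_max_right _ _
    calc R / p * (|q - p| / q) * ‖h‖ ≤ 1 * (|q - p| / q) * q := by gcongr
      _ = |q - p| := by field_simp
      _ ≤ _ := h3
  rw [e]
  refine (norm_add_le _ _).trans ?_
  rw [norm_smul, norm_smul, Real.norm_eq_abs, Real.norm_eq_abs,
    abs_of_nonneg (by positivity : 0 ≤ R / p)]
  nlinarith [norm_nonneg (f - h)]

theorem continuous_retr {R : ℝ} (hR : 0 < R) : Continuous (retr R) :=
  (LipschitzWith.of_dist_le_mul (K := 2) fun f h => by
    simpa [dist_eq_norm] using norm_retr_sub_le hR f h).continuous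

theorem coeFn_fourierL2_smul (c : ℝ) (f : L2R) :
    ∀ᵐ ξ : ℝ, fourierL2 (c • f) ξ = (c : ℂ) * fourierL2 f ξ := by
  rw [fourierL2_smul]
  filter_upwards [Lp.coeFn_smul (c : ℂ) (fourierL2 f)] with ξ hξ
  rw [hξ]
  rfl

theorem norm_fourierL2_retr_le {R : ℝ} (hR : 0 < R) (f : L2R) :
    ∀ᵐ ξ : ℝ, ‖fourierL2 (retr R f) ξ‖ ≤ ‖fourierL2 f ξ‖ := by
  have hm : 0 < max R ‖f‖ := lt_max_of_lt_left hR
  filter_upwards [coeFn_fourierL2_smul (R / max R ‖f‖) f] with ξ hξ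
  rw [retr, hξ, norm_mul, Complex.norm_real, Real.norm_of_nonneg (by positivity)]
  have : R / max R ‖f‖ ≤ 1 := (div_le_one hm).mpr (le_max_left _ _)
  exact mul_le_of_le_one_left (norm_nonneg _) this

/-- The truncated nonlinearity on the Fourier side. -/
def trunc (R : ℝ) (f : L2R) (ξ : ℝ) : ℂ := fourierMul (retr R f) (retr R f) ξ

theorem continuous_trunc {R : ℝ} (hR : 0 < R) :
    Continuous fun p : L2R × ℝ => trunc R p.1 p.2 := by
  have h : Continuous fun p : L2R × ℝ => (retr R p.1, p.2) :=
    ((continuous_retr hR).comp continuous_fst).prodMk continuous_snd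
  exact continuous_fourierMul_self.comp h

theorem trunc_neg (R : ℝ) (f : L2R) (ξ : ℝ) : trunc R f (-ξ) = starRingEnd ℂ (trunc R f ξ) :=
  fourierMul_neg _ _ _

theorem norm_trunc_sub_le {R : ℝ} (hR : 0 < R) (f h : L2R) (ξ : ℝ) :
    ‖trunc R f ξ - trunc R h ξ‖ ≤ 4 * R * ‖f - h‖ := by
  refine (norm_fourierMul_self_sub_le _ _ _).trans ?_
  have h1 := norm_retr_sub_le hR f h
  have h2 : ‖retr R f + retr R h‖ ≤ 2 * R :=
    (norm_add_le _ _).trans (by linarith [norm_retr_le hR f, norm_retr_le hR h])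
  nlinarith [mul_le_mul h1 h2 (norm_nonneg _) (by positivity)]

theorem norm_trunc_le {R : ℝ} (hR : 0 < R) (f : L2R) (ξ : ℝ) : ‖trunc R f ξ‖ ≤ R ^ 2 := by
  refine (norm_fourierMul_le _ _ _).trans ?_
  have := norm_retr_le hR f
  nlinarith [norm_nonneg (retr R f)]

theorem IsWeight.aestronglyMeasurable {c : ℝ} {w : ℝ → ℝ} (hw : IsWeight c w) {f : ℝ → ℂ}
    (hf : AEStronglyMeasurable f) : AEStronglyMeasurable (fun ξ => (w ξ : ℂ) * f ξ) :=
  (Complex.continuous_ofReal.comp hw.continuous).aestronglyMeasurable.mul hf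

/-- The retraction bounds the L² factor of the tame estimate by `R` and does not increase the
weighted factor, so the bound becomes linear in the weighted norm. -/
theorem IsWeight.mul_norm_trunc_le {c : ℝ} {w : ℝ → ℝ} (hw : IsWeight c w) {R : ℝ} (hR : 0 < R)
    {f : L2R} (hf : MemLp (fun ξ => (w ξ : ℂ) * fourierL2 f ξ) 2) (ξ : ℝ) :
    w ξ * ‖trunc R f ξ‖ ≤ 2 * c * R * n2 (fun ξ => (w ξ : ℂ) * fourierL2 f ξ) := by
  have hle : ∀ᵐ ξ : ℝ, ‖(w ξ : ℂ) * fourierL2 (retr R f) ξ‖ ≤ ‖(w ξ : ℂ) * fourierL2 f ξ‖ := by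
    filter_upwards [norm_fourierL2_retr_le hR f] with ξ hξ
    rw [norm_mul, norm_mul]
    gcongr
  have hm : MemLp (fun ξ => (w ξ : ℂ) * fourierL2 (retr R f) ξ) 2 :=
    hf.of_le (hw.aestronglyMeasurable (Lp.aestronglyMeasurable _)) hle
  refine (hw.mul_norm_fourierMul_self_le hm ξ).trans ?_
  have := hw.const_nonneg
  have h1 := norm_retr_le hR f
  have h2 := n2_mono hf hle
  have h3 := n2_nonneg (fun ξ => (w ξ : ℂ) * fourierL2 (retr R f) ξ)
  gcongr

/-! ### Sobolev weights. -/

/-- The truncated Sobolev weights. -/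
def wtm (n : ℕ) (m : ℝ) (ξ : ℝ) : ℝ := (min m (Real.sqrt (1 + ξ ^ 2))) ^ n

/-- The Sobolev weight. -/
def wt (n : ℕ) (ξ : ℝ) : ℝ := Real.sqrt (1 + ξ ^ 2) ^ n

theorem one_le_bracket (ξ : ℝ) : 1 ≤ Real.sqrt (1 + ξ ^ 2) := by
  rw [Real.one_le_sqrt]
  nlinarith [sq_nonneg ξ]

theorem bracket_le_add (ξ η : ℝ) :
    Real.sqrt (1 + ξ ^ 2) ≤ Real.sqrt (1 + η ^ 2) + Real.sqrt (1 + (η + ξ) ^ 2) := by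
  have hA := Real.sq_sqrt (by positivity : 0 ≤ 1 + η ^ 2)
  have hB := Real.sq_sqrt (by positivity : 0 ≤ 1 + (η + ξ) ^ 2)
  have hA1 : |η| ≤ Real.sqrt (1 + η ^ 2) := Real.abs_le_sqrt (by linarith)
  have hB1 : |η + ξ| ≤ Real.sqrt (1 + (η + ξ) ^ 2) := Real.abs_le_sqrt (by linarith)
  -- Since ξ = (η + ξ) - η, the cross term of ξ² is at most 2|η||η + ξ|, which the cross term in the
  -- square of the right-hand side dominates.
  have hAB := mul_le_mul hA1 hB1 (abs_nonneg _) (Real.sqrt_nonneg _)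
  rw [← abs_mul] at hAB
  have h0 := neg_abs_le (η * (η + ξ))
  refine Real.sqrt_le_iff.mpr ⟨by positivity, ?_⟩
  nlinarith

theorem add_pow_le_two_pow {x y : ℝ} (hx : 0 ≤ x) (hy : 0 ≤ y) (n : ℕ) :
    (x + y) ^ n ≤ 2 ^ n * (x ^ n + y ^ n) := by
  refine (add_pow_le hx hy n).trans ?_
  gcongr
  · norm_num
  · omega

theorem isWeight_wt (n : ℕ) : IsWeight (2 ^ n) (wt n) where
  continuous := by unfold wt; fun_prop
  one_le ξ := one_le_pow₀ (one_le_bracket ξ)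
  le_add ξ η := (pow_le_pow_left₀ (Real.sqrt_nonneg _) (bracket_le_add ξ η) n).trans
    (add_pow_le_two_pow (Real.sqrt_nonneg _) (Real.sqrt_nonneg _) n)

/-- Capping at `m` preserves subadditivity. The constant does not depend on `m`, so bounds proved
for these bounded weights pass to the limit. -/
theorem isWeight_wtm (n : ℕ) {m : ℝ} (hm : 1 ≤ m) : IsWeight (2 ^ n) (wtm n m) where
  continuous := by unfold wtm; fun_prop
  one_le ξ := one_le_pow₀ (le_min hm (one_le_bracket ξ))
  le_add ξ η := by
    have h0 : ∀ ζ : ℝ, 0 ≤ min m (Real.sqrt (1 + ζ ^ 2)) := fun ζ => by positivity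
    refine (pow_le_pow_left₀ (h0 ξ) (?_ : _ ≤ min m (Real.sqrt (1 + η ^ 2)) +
      min m (Real.sqrt (1 + (η + ξ) ^ 2))) n).trans (add_pow_le_two_pow (h0 _) (h0 _) n)
    have h1 := h0 η
    have h2 := h0 (η + ξ)
    rcases le_total m (Real.sqrt (1 + η ^ 2)) with h | h
    · rw [min_eq_left h]
      exact (min_le_left _ _).trans (by linarith)
    · rcases le_total m (Real.sqrt (1 + (η + ξ) ^ 2)) with h' | h'
      · rw [min_eq_left h']
        exact (min_le_left _ _).trans (by linarith)
      · rw [min_eq_right h, min_eq_right h']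
        exact (min_le_right _ _).trans (bracket_le_add ξ η)

theorem wtm_le_wt (n : ℕ) {m : ℝ} (hm : 1 ≤ m) (ξ : ℝ) : wtm n m ξ ≤ wt n ξ := by
  unfold wtm wt
  gcongr
  exact min_le_right _ _

theorem wtm_le (n : ℕ) {m : ℝ} (hm : 1 ≤ m) (ξ : ℝ) : wtm n m ξ ≤ m ^ n := by
  unfold wtm
  gcongr
  exact min_le_left _ _

theorem isWeight_one : IsWeight 1 fun _ => 1 where
  continuous := continuous_const
  one_le _ := le_rfl
  le_add _ _ := by norm_num

/-! ### Weighted bounds for the linear equation with a source. -/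

theorem continuous_sol_left (a b : ℝ) (c : ℝ → ℂ) {g : ℝ → ℝ → ℂ} {ξ : ℝ}
    (hg : Continuous fun s => g s ξ) : Continuous fun s => sol a b c g s ξ :=
  continuous_iff_continuousAt.mpr fun s => (hasDerivAt_sol a b c hg s).continuousAt

theorem aestronglyMeasurable_sol (a b : ℝ) {c : ℝ → ℂ} {g : ℝ → ℝ → ℂ}
    (hc : AEStronglyMeasurable c)
    (hg : Continuous (Function.uncurry g)) (t : ℝ) : AEStronglyMeasurable (sol a b c g t) := by
  have h1 : Continuous fun ξ => Complex.exp (-(t : ℂ) * psi a b ξ) := by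
    have := continuous_psi a b
    fun_prop
  have h2 : Continuous fun ξ => duh a b g t ξ :=
    (continuous_duh a b hg).comp (continuous_const.prodMk continuous_id)
  have h3 : Continuous fun ξ : ℝ => (Real.pi * Complex.I * ξ : ℂ) * duh a b g t ξ := by fun_prop
  exact (h1.aestronglyMeasurable.mul hc).sub h3.aestronglyMeasurable

theorem norm_mul_sol_le {a : ℝ} (ha : 0 < a) (b : ℝ) {g : ℝ → ℝ → ℂ} {t μ Γ ξ : ℝ} (ht : 0 ≤ t) (hμ : 0 < μ) (w c : ℝ → ℂ)
    (hΓ : ∀ s ∈ Icc 0 t, ‖w ξ‖ * ‖g s ξ‖ ≤ Γ * Real.exp ((a ^ 3 + μ) * s)) :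
    ‖w ξ * sol a b c g t ξ‖ ≤ Real.exp (a ^ 3 * t) * ‖w ξ * c ξ‖ +
      Real.pi * Γ * Real.exp ((a ^ 3 + μ) * t) * kf μ ξ := by
  have h1 := norm_exp_psi_le' ha b ht ξ
  have h2 := norm_duhamel_le (g := fun s ξ => w ξ * g s ξ) ha b ht hμ (A := Γ) (ξ := ξ)
    (by simpa only [norm_mul] using hΓ)
  have h3 : duh a b (fun s ξ => w ξ * g s ξ) t ξ = w ξ * duh a b g t ξ := by
    rw [duh, duh, ← intervalIntegral.integral_const_mul]
    congr 1
    ext s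
    ring
  rw [h3] at h2
  have e : w ξ * sol a b c g t ξ = Complex.exp (-(t : ℂ) * psi a b ξ) * (w ξ * c ξ) -
      (Real.pi * Complex.I * ξ : ℂ) * (w ξ * duh a b g t ξ) := by
    rw [sol]; ring
  rw [e]
  refine (norm_sub_le _ _).trans (add_le_add ?_ h2)
  rw [norm_mul]
  gcongr

theorem memLp_two_const_mul_norm {f : ℝ → ℂ} (hf : MemLp f 2) (r : ℝ) :
    MemLp (fun ξ => ((r * ‖f ξ‖ : ℝ) : ℂ)) 2 :=
  (hf.norm.const_mul r).ofReal

/-- Square integrable domination by a sum. -/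
theorem memLp_and_n2_le_of_le_add {F f k : ℝ → ℂ} {r q : ℝ} (hr : 0 ≤ r) (hq : 0 ≤ q)
    (hF : AEStronglyMeasurable F) (hf : MemLp f 2) (hk : MemLp k 2)
    (h : ∀ᵐ ξ, ‖F ξ‖ ≤ r * ‖f ξ‖ + q * ‖k ξ‖) : MemLp F 2 ∧ n2 F ≤ r * n2 f + q * n2 k := by
  have m1 := memLp_two_const_mul_norm hf r
  have m2 := memLp_two_const_mul_norm hk q
  have m3 : MemLp (fun ξ => ((r * ‖f ξ‖ : ℝ) : ℂ) + ((q * ‖k ξ‖ : ℝ) : ℂ)) 2 := m1.add m2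
  have hle : ∀ᵐ ξ, ‖F ξ‖ ≤ ‖((r * ‖f ξ‖ : ℝ) : ℂ) + ((q * ‖k ξ‖ : ℝ) : ℂ)‖ := by
    filter_upwards [h] with ξ hξ
    rw [← Complex.ofReal_add, Complex.norm_real, Real.norm_of_nonneg (by positivity)]
    exact hξ
  have e : ∀ (r : ℝ) (f : ℝ → ℂ), 0 ≤ r → n2 (fun ξ => ((r * ‖f ξ‖ : ℝ) : ℂ)) = r * n2 f := by
    intro r f hr
    rw [n2]
    simp_rw [Complex.norm_real, norm_mul, norm_norm, mul_pow]
    rw [integral_const_mul, Real.sqrt_mul (by positivity), Real.sqrt_sq (norm_nonneg _),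
      Real.norm_of_nonneg hr, n2]
  refine ⟨m3.of_le hF hle, (n2_mono m3 hle).trans ((n2_add_le m1 m2).trans_eq ?_)⟩
  rw [e r f hr, e q k hq]

theorem norm_kf (μ ξ : ℝ) : ‖((kf μ ξ : ℝ) : ℂ)‖ = kf μ ξ := by
  rw [Complex.norm_real, Real.norm_of_nonneg (kf_nonneg _ _)]

theorem IsWeight.norm_coe {d : ℝ} {w : ℝ → ℝ} (hw : IsWeight d w) (ξ : ℝ) :
    ‖((w ξ : ℝ) : ℂ)‖ = w ξ := by
  rw [Complex.norm_real, Real.norm_of_nonneg (hw.nonneg ξ)]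

theorem const_nonneg_of_source {w : ℝ → ℝ} {d : ℝ} (hw : IsWeight d w) {g : ℝ → ℝ → ℂ}
    {t κ Γ : ℝ} (ht : 0 ≤ t)
    (hΓ : ∀ s ∈ Icc 0 t, ∀ ξ, w ξ * ‖g s ξ‖ ≤ Γ * Real.exp (κ * s)) : 0 ≤ Γ := by
  have := (mul_nonneg (hw.nonneg 0) (norm_nonneg _)).trans (hΓ 0 ⟨le_rfl, ht⟩ 0)
  simpa using this

/-- A weight commutes with all the multipliers, so the estimate is pointwise in frequency: a sup
bound on the weighted source becomes a multiple of the square integrable profile `kf μ`. -/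
theorem IsWeight.sol_bound {a : ℝ} (ha : 0 < a) (b : ℝ) {c : ℝ → ℂ} {g : ℝ → ℝ → ℂ} {d : ℝ}
    {w : ℝ → ℝ} (hw : IsWeight d w) (hc : AEStronglyMeasurable c)
    (hwc : MemLp (fun ξ => (w ξ : ℂ) * c ξ) 2)
    (hg : Continuous (Function.uncurry g)) {t μ Γ : ℝ} (ht : 0 ≤ t) (hμ : 0 < μ)
    (hΓ : ∀ s ∈ Icc 0 t, ∀ ξ, w ξ * ‖g s ξ‖ ≤ Γ * Real.exp ((a ^ 3 + μ) * s)) :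
    MemLp (fun ξ => (w ξ : ℂ) * sol a b c g t ξ) 2 ∧
      n2 (fun ξ => (w ξ : ℂ) * sol a b c g t ξ) ≤ Real.exp ((a ^ 3 + μ) * t) *
        (n2 (fun ξ => (w ξ : ℂ) * c ξ) + Real.pi * Γ * n2 (fun ξ => ((kf μ ξ : ℝ) : ℂ))) := by
  have hΓ0 := const_nonneg_of_source hw ht hΓ
  have key := memLp_and_n2_le_of_le_add (r := Real.exp ((a ^ 3 + μ) * t))
    (q := Real.pi * Γ * Real.exp ((a ^ 3 + μ) * t))
    (by positivity) (by have := Real.pi_pos; positivity)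
    (hw.aestronglyMeasurable (aestronglyMeasurable_sol a b hc hg t)) hwc (memLp_kf hμ)
    (Eventually.of_forall fun ξ => ?_)
  · refine ⟨key.1, key.2.trans_eq (by ring)⟩
  · refine (norm_mul_sol_le ha b ht hμ (fun ξ => (w ξ : ℂ)) c (Γ := Γ) fun s hs => ?_).trans ?_
    · rw [hw.norm_coe]
      exact hΓ s hs ξ
    · rw [norm_kf]
      have : Real.exp (a ^ 3 * t) ≤ Real.exp ((a ^ 3 + μ) * t) :=
        Real.exp_le_exp.mpr (by nlinarith)
      gcongr

theorem n2_sol_sub_le {a : ℝ} (ha : 0 < a) (b : ℝ) {c : ℝ → ℂ} {g h : ℝ → ℝ → ℂ}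
    (hg : Continuous (Function.uncurry g)) (hh : Continuous (Function.uncurry h))
    {t μ Γ : ℝ} (ht : 0 ≤ t) (hμ : 0 < μ)
    (hΓ : ∀ s ∈ Icc 0 t, ∀ ξ, ‖g s ξ - h s ξ‖ ≤ Γ * Real.exp ((a ^ 3 + μ) * s)) :
    n2 (fun ξ => sol a b c g t ξ - sol a b c h t ξ) ≤
      Real.exp ((a ^ 3 + μ) * t) * (Real.pi * Γ * n2 (fun ξ => ((kf μ ξ : ℝ) : ℂ))) := by
  have hgh : Continuous (Function.uncurry fun s ξ => g s ξ - h s ξ) := hg.sub hh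
  -- The free parts cancel: the difference solves the equation with zero datum.
  have key := (isWeight_one.sol_bound ha b (c := 0) (aestronglyMeasurable_const)
    (by simp) hgh ht hμ (Γ := Γ) (by simpa using hΓ)).2
  have e : n2 (fun ξ => sol a b c g t ξ - sol a b c h t ξ) =
      n2 (fun ξ => ((1 : ℝ) : ℂ) * sol a b 0 (fun s ξ => g s ξ - h s ξ) t ξ) := by
    rw [n2, n2]
    congr 2
    ext ξ
    rw [sol, sol, sol, ← duh_sub a b hg hh]
    congr 2
    simp
    ring
  rw [e]
  refine key.trans_eq ?_
  simp [n2]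

theorem IsWeight.exists_sol_dominated {a : ℝ} (ha : 0 < a) (b : ℝ) {c : ℝ → ℂ}
    {g : ℝ → ℝ → ℂ} {d : ℝ} {w : ℝ → ℝ} (hw : IsWeight d w)
    (hwc : MemLp (fun ξ => (w ξ : ℂ) * c ξ) 2) {T Γ : ℝ}
    (hΓ : ∀ s ∈ Icc 0 T, ∀ ξ, w ξ * ‖g s ξ‖ ≤ Γ) :
    ∃ B : ℝ → ℝ, MemLp B 2 ∧ ∀ s ∈ Icc 0 T, ∀ ξ, ‖(w ξ : ℂ) * sol a b c g s ξ‖ ≤ B ξ := by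
  refine ⟨fun ξ => Real.exp (a ^ 3 * T) * ‖(w ξ : ℂ) * c ξ‖ +
      Real.pi * Γ * Real.exp ((a ^ 3 + 1) * T) * kf 1 ξ, ?_, fun s hs ξ => ?_⟩
  · refine MemLp.add (hwc.norm.const_mul _) (MemLp.const_mul ?_ _)
    simpa only [norm_kf] using (memLp_kf one_pos).norm
  · have hΓ0 : 0 ≤ Γ := (mul_nonneg (hw.nonneg 0) (norm_nonneg _)).trans (hΓ s hs 0)
    refine (norm_mul_sol_le ha b hs.1 one_pos (fun ξ => (w ξ : ℂ)) c (Γ := Γ)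
      fun r hr => ?_).trans ?_
    · rw [hw.norm_coe]
      refine (hΓ r ⟨hr.1, hr.2.trans hs.2⟩ ξ).trans ?_
      refine le_mul_of_one_le_right hΓ0 (Real.one_le_exp ?_)
      have := hr.1
      positivity
    · have h1 : Real.exp (a ^ 3 * s) ≤ Real.exp (a ^ 3 * T) :=
        Real.exp_le_exp.mpr (mul_le_mul_of_nonneg_left hs.2 (by positivity))
      have h2 : Real.exp ((a ^ 3 + 1) * s) ≤ Real.exp ((a ^ 3 + 1) * T) :=
        Real.exp_le_exp.mpr (mul_le_mul_of_nonneg_left hs.2 (by positivity))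
      have h3 := kf_nonneg 1 ξ
      have h4 := Real.pi_pos
      beta_reduce
      gcongr

/-- Dominated convergence, from continuity in time at each frequency and a majorant uniform in time.
-/
theorem IsWeight.tendsto_n2_sol_sub {a : ℝ} (ha : 0 < a) (b : ℝ) {c : ℝ → ℂ} {g : ℝ → ℝ → ℂ}
    {d : ℝ} {w : ℝ → ℝ} (hw : IsWeight d w) (hc : AEStronglyMeasurable c)
    (hwc : MemLp (fun ξ => (w ξ : ℂ) * c ξ) 2)
    (hg : Continuous (Function.uncurry g)) {t T Γ : ℝ} (ht : t ∈ Icc 0 T)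
    (hΓ : ∀ s ∈ Icc 0 T, ∀ ξ, w ξ * ‖g s ξ‖ ≤ Γ) :
    Tendsto (fun s => n2 (fun ξ => (w ξ : ℂ) * (sol a b c g s ξ - sol a b c g t ξ)))
      (𝓝[Icc 0 T] t) (𝓝 0) := by
  obtain ⟨B, hB2, hbd⟩ := hw.exists_sol_dominated ha b hwc hΓ
  have hint : Tendsto
      (fun s => ∫ ξ, ‖(w ξ : ℂ) * (sol a b c g s ξ - sol a b c g t ξ)‖ ^ 2)
      (𝓝[Icc 0 T] t) (𝓝 (∫ _ : ℝ, 0)) := by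
    refine tendsto_integral_filter_of_dominated_convergence (fun ξ => (2 * B ξ) ^ 2) ?_ ?_ ?_ ?_
    · refine Eventually.of_forall fun s => ?_
      exact (hw.aestronglyMeasurable ((aestronglyMeasurable_sol a b hc hg s).sub
        (aestronglyMeasurable_sol a b hc hg t))).norm.pow 2
    · filter_upwards [self_mem_nhdsWithin] with s hs
      refine Eventually.of_forall fun ξ => ?_
      have h1 := (norm_sub_le ((w ξ : ℂ) * sol a b c g s ξ) ((w ξ : ℂ) * sol a b c g t ξ)).trans
        (add_le_add (hbd s hs ξ) (hbd t ht ξ))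
      rw [← mul_sub, ← two_mul] at h1
      rw [Real.norm_of_nonneg (sq_nonneg _)]
      exact pow_le_pow_left₀ (norm_nonneg _) h1 2
    · exact (hB2.const_mul 2).integrable_sq
    · refine Eventually.of_forall fun ξ => ?_
      have hcont : Continuous fun s => sol a b c g s ξ :=
        continuous_sol_left a b c (hg.comp (f := fun s => (s, ξ)) (by fun_prop))
      have h1 : Continuous fun s =>
          ‖(w ξ : ℂ) * (sol a b c g s ξ - sol a b c g t ξ)‖ ^ 2 :=
        ((continuous_const.mul (hcont.sub continuous_const)).norm).pow 2
      have h2 := (h1.tendsto t).mono_left (nhdsWithin_le_nhds (s := Icc 0 T))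
      simpa using h2
  have h3 := (Real.continuous_sqrt.tendsto _).comp hint
  simpa [n2, Function.comp_def] using h3

/-! ### The truncated problem: contraction, uniqueness, existence. -/

/-- The quarter power of the exponential rate for which the fixed point map contracts. -/
def rate (n : ℕ) (R : ℝ) : ℝ := 1 + 8 * 2 ^ n * Real.pi * Real.sqrt Real.pi * R

theorem one_le_rate (n : ℕ) {R : ℝ} (hR : 0 ≤ R) : 1 ≤ rate n R := by
  have := Real.pi_pos
  unfold rate
  have : 0 ≤ 8 * 2 ^ n * Real.pi * Real.sqrt Real.pi * R := by positivity
  linarith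

theorem rate_pow_pos (n : ℕ) {R : ℝ} (hR : 0 < R) : 0 < rate n R ^ 4 :=
  pow_pos (zero_lt_one.trans_le (one_le_rate n hR.le)) 4

/-- The factor `4 * 2 ^ n * R` dominates both the Lipschitz constant `4 * R` of the truncated
nonlinearity and its tame constant `2 * 2 ^ n * R`. The 8 in `rate` is this 4 divided by 1/2. -/
theorem pi_mul_n2_kf_rate_le (n : ℕ) {R : ℝ} (hR : 0 < R) :
    Real.pi * (4 * 2 ^ n * R) * n2 (fun ξ => ((kf (rate n R ^ 4) ξ : ℝ) : ℂ)) ≤ 1 / 2 := by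
  have h1 := one_le_rate n hR.le
  rw [n2_kf (by linarith), mul_div_assoc', div_le_iff₀ (by linarith)]
  unfold rate
  nlinarith

/-- The real function whose Fourier transform is `F`, if `F ∈ L²` has the Hermitian symmetry. -/
def realOf (F : ℝ → ℂ) : L2R :=
  open scoped Classical in if h : MemLp F 2 then reFourierInv (h.toLp F) else 0

theorem norm_realOf_sub_le {F G : ℝ → ℂ} (hF : MemLp F 2) (hG : MemLp G 2) :
    ‖realOf F - realOf G‖ ≤ n2 (fun ξ => F ξ - G ξ) := by
  rw [realOf, realOf, dif_pos hF, dif_pos hG]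
  refine (norm_reFourierInv_sub_le _ _).trans_eq ?_
  rw [← MemLp.toLp_sub, ← n2_eq_norm_toLp]
  rfl

theorem fourierL2_realOf {F : ℝ → ℂ} (hF : MemLp F 2)
    (h : ∀ᵐ ξ, F (-ξ) = starRingEnd ℂ (F ξ)) : fourierL2 (realOf F) =ᵐ[volume] F := by
  rw [realOf, dif_pos hF, fourierL2_reFourierInv]
  · exact hF.coeFn_toLp
  · have h2 := (Measure.measurePreserving_neg (volume : Measure ℝ)).quasiMeasurePreserving.ae_eq
      hF.coeFn_toLp
    filter_upwards [h, h2, hF.coeFn_toLp] with ξ e1 e2 e3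
    rw [e3, ← e1]
    exact e2

/-- A continuous curve that solves the Fourier side of the equation with truncated
nonlinearity. -/
structure TruncSol (a b R T : ℝ) (u₀ : L2R) (u : ℝ → L2R) : Prop where
  continuous : Continuous u
  eq : ∀ t ∈ Icc 0 T, fourierL2 (u t) =ᵐ[volume]
    sol a b (fourierL2 u₀) (fun s ξ => trunc R (u s) ξ) t

theorem continuous_uncurry_trunc {R : ℝ} (hR : 0 < R) {u : ℝ → L2R} (hu : Continuous u) :
    Continuous (Function.uncurry fun s ξ => trunc R (u s) ξ) := by
  have h : Continuous fun p : ℝ × ℝ => (u p.1, p.2) :=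
    (hu.comp continuous_fst).prodMk continuous_snd
  have h2 := (continuous_trunc hR).comp h
  refine h2.congr ?_
  rintro ⟨s, ξ⟩
  rfl

theorem sol_neg (a b : ℝ) (u₀ : L2R) (R : ℝ) (u : ℝ → L2R) (t : ℝ) :
    ∀ᵐ ξ : ℝ, sol a b (fourierL2 u₀) (fun s ξ => trunc R (u s) ξ) t (-ξ) =
      starRingEnd ℂ (sol a b (fourierL2 u₀) (fun s ξ => trunc R (u s) ξ) t ξ) := by
  filter_upwards [fourierL2_neg_eq_conj u₀] with ξ hξ
  simp only [sol, hξ, duh_neg a b (fun s ξ => trunc_neg R (u s) ξ) t ξ, psi_neg, map_sub, map_mul,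
    ← Complex.exp_conj, map_neg, Complex.conj_ofReal, Complex.conj_I]
  push_cast
  ring

theorem memLp_sol {a : ℝ} (ha : 0 < a) (b : ℝ) (u₀ : L2R) {R : ℝ} (hR : 0 < R) {u : ℝ → L2R}
    (hu : Continuous u) {t : ℝ} (ht : 0 ≤ t) :
    MemLp (sol a b (fourierL2 u₀) (fun s ξ => trunc R (u s) ξ) t) 2 := by
  have := (isWeight_one.sol_bound ha b (Lp.aestronglyMeasurable (fourierL2 u₀))
    (by simpa using Lp.memLp (fourierL2 u₀)) (continuous_uncurry_trunc hR hu) ht one_pos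
    (Γ := R ^ 2) fun s hs ξ => ?_).1
  · simpa using this
  · rw [one_mul]
    refine (norm_trunc_le hR _ _).trans (le_mul_of_one_le_right (by positivity)
      (Real.one_le_exp ?_))
    have := hs.1
    positivity

/-- The contraction: one application of the solution map halves the distance in the norm weighted by
e^{-(a³+μ)s}. -/
theorem n2_sol_trunc_sub_le {a : ℝ} (ha : 0 < a) (b : ℝ) (n : ℕ) (u₀ : L2R) {R : ℝ} (hR : 0 < R)
    {u v : ℝ → L2R} (hu : Continuous u) (hv : Continuous v) {T D : ℝ} (hD : 0 ≤ D)
    (h : ∀ s ∈ Icc 0 T, ‖u s - v s‖ ≤ D * Real.exp ((a ^ 3 + rate n R ^ 4) * s)) {t : ℝ}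
    (ht : t ∈ Icc 0 T) :
    n2 (fun ξ => sol a b (fourierL2 u₀) (fun s ξ => trunc R (u s) ξ) t ξ -
      sol a b (fourierL2 u₀) (fun s ξ => trunc R (v s) ξ) t ξ) ≤
      D / 2 * Real.exp ((a ^ 3 + rate n R ^ 4) * t) := by
  refine (n2_sol_sub_le ha b (continuous_uncurry_trunc hR hu) (continuous_uncurry_trunc hR hv)
    ht.1 (rate_pow_pos n hR) (Γ := 4 * 2 ^ n * R * D) fun s hs ξ => ?_).trans ?_
  · refine (norm_trunc_sub_le hR _ _ _).trans ?_
    have h1 := h s ⟨hs.1, hs.2.trans ht.2⟩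
    have h2 : (1 : ℝ) ≤ 2 ^ n := one_le_pow₀ (by norm_num)
    calc 4 * R * ‖u s - v s‖ ≤ 4 * R * (D * Real.exp ((a ^ 3 + rate n R ^ 4) * s)) := by gcongr
      _ ≤ 2 ^ n * (4 * R * (D * Real.exp ((a ^ 3 + rate n R ^ 4) * s))) :=
          le_mul_of_one_le_left (by positivity) h2
      _ = _ := by ring
  · have h1 := pi_mul_n2_kf_rate_le n hR
    have h2 := Real.exp_pos ((a ^ 3 + rate n R ^ 4) * t)
    calc _ = Real.exp ((a ^ 3 + rate n R ^ 4) * t) * D * (Real.pi * (4 * 2 ^ n * R) *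
          n2 (fun ξ => ((kf (rate n R ^ 4) ξ : ℝ) : ℂ))) := by ring
      _ ≤ Real.exp ((a ^ 3 + rate n R ^ 4) * t) * D * (1 / 2) := by gcongr
      _ = _ := by ring

theorem exists_norm_le_on_Icc {T : ℝ} {u : ℝ → L2R} (hu : Continuous u) :
    ∃ M, 0 ≤ M ∧ ∀ s ∈ Icc 0 T, ‖u s‖ ≤ M := by
  obtain ⟨M, hM⟩ := isCompact_Icc.exists_bound_of_continuousOn (hu.continuousOn (s := Icc 0 T))
  exact ⟨max M 0, le_max_right _ _, fun s hs => (hM s hs).trans (le_max_left _ _)⟩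

/-- The difference is bounded on [0,T], and each use of the equation halves its weighted bound. -/
theorem TruncSol.unique {a : ℝ} (ha : 0 < a) {b R T : ℝ} (hR : 0 < R) {u₀ : L2R}
    {u v : ℝ → L2R} (hu : TruncSol a b R T u₀ u) (hv : TruncSol a b R T u₀ v) :
    EqOn u v (Icc 0 T) := by
  obtain ⟨M, hM0, hM⟩ := exists_norm_le_on_Icc (T := T) (hu.continuous.sub hv.continuous)
  set lam := a ^ 3 + rate 0 R ^ 4 with hlam
  have hlam0 : 0 < lam := add_pos (pow_pos ha 3) (rate_pow_pos 0 hR)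
  have key : ∀ k : ℕ, ∀ s ∈ Icc 0 T, ‖u s - v s‖ ≤ M / 2 ^ k * Real.exp (lam * s) := by
    intro k
    induction k with
    | zero =>
      intro s hs
      rw [pow_zero, div_one]
      refine (hM s hs).trans (le_mul_of_one_le_right hM0 (Real.one_le_exp ?_))
      have := hs.1
      positivity
    | succ k ih =>
      intro t ht
      have h1 := n2_sol_trunc_sub_le ha b 0 u₀ hR hu.continuous hv.continuous (by positivity) ih ht
      have h2 : ‖u t - v t‖ = n2 (fun ξ =>
          sol a b (fourierL2 u₀) (fun s ξ => trunc R (u s) ξ) t ξ -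
          sol a b (fourierL2 u₀) (fun s ξ => trunc R (v s) ξ) t ξ) := by
        rw [← n2_fourierL2, fourierL2_sub]
        refine n2_congr ?_
        filter_upwards [Lp.coeFn_sub (fourierL2 (u t)) (fourierL2 (v t)), hu.eq t ht, hv.eq t ht]
          with ξ e1 e2 e3
        rw [e1, Pi.sub_apply, e2, e3]
      rw [h2, pow_succ, ← div_div]
      exact h1
  intro s hs
  rw [← sub_eq_zero, ← norm_le_zero_iff]
  have hlim : Tendsto (fun k : ℕ => M / 2 ^ k * Real.exp (lam * s)) atTop (𝓝 0) := by
    have h1 : Tendsto (fun k : ℕ => M * (1 / 2 : ℝ) ^ k * Real.exp (lam * s)) atTop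
        (𝓝 (M * 0 * Real.exp (lam * s))) :=
      ((tendsto_pow_atTop_nhds_zero_of_lt_one (by norm_num) (by norm_num)).const_mul M).mul_const _
    simpa [div_eq_mul_inv] using h1
  exact ge_of_tendsto hlim (Eventually.of_forall fun k => key k s hs)

/-- Banach's fixed point theorem for the unknown v(t) = e^{-λt} u(t): the exponential weight sits in
the unknown, so the usual sup norm on C([0,T]; L²) can be used. No smallness of `T` is needed. -/
theorem exists_truncSol {a : ℝ} (ha : 0 < a) (b : ℝ) {R T : ℝ} (hR : 0 < R) (hT : 0 ≤ T)
    (u₀ : L2R) : ∃ u, TruncSol a b R T u₀ u := by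
  set lam := a ^ 3 + rate 0 R ^ 4 with hlam
  -- Restores u from v, with v frozen outside [0,T] so that the curve is continuous on the whole
  -- line.
  set ext : C(Icc (0 : ℝ) T, L2R) → ℝ → L2R :=
    fun v s => Real.exp (lam * s) • v (projIcc 0 T hT s) with hext
  have hextc : ∀ v, Continuous (ext v) := fun v => by
    have : Continuous fun s => v (projIcc 0 T hT s) := v.continuous.comp continuous_projIcc
    fun_prop
  set S : C(Icc (0 : ℝ) T, L2R) → ℝ → ℝ → ℂ :=
    fun v => sol a b (fourierL2 u₀) (fun s ξ => trunc R (ext v s) ξ) with hS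
  have hSm : ∀ v t, 0 ≤ t → MemLp (S v t) 2 := fun v t ht => memLp_sol ha b u₀ hR (hextc v) ht
  have hSc : ∀ v, Continuous fun t : Icc (0 : ℝ) T => realOf (S v t) := by
    intro v
    rw [continuous_iff_continuousAt]
    intro t
    have h1 := isWeight_one.tendsto_n2_sol_sub ha b (Lp.aestronglyMeasurable (fourierL2 u₀))
      (by simpa using Lp.memLp (fourierL2 u₀)) (continuous_uncurry_trunc hR (hextc v)) t.2
      (Γ := R ^ 2) (fun s _ ξ => by rw [one_mul]; exact norm_trunc_le hR _ _)
    have h2 : Tendsto (fun s : Icc (0 : ℝ) T => (s : ℝ)) (𝓝 t) (𝓝[Icc 0 T] (t : ℝ)) :=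
      tendsto_nhdsWithin_iff.mpr
        ⟨continuous_subtype_val.tendsto t, Eventually.of_forall fun s => s.2⟩
    rw [ContinuousAt, tendsto_iff_norm_sub_tendsto_zero]
    refine squeeze_zero (fun _ => norm_nonneg _) (fun s => ?_) (h1.comp h2)
    refine (norm_realOf_sub_le (hSm v s s.2.1) (hSm v t t.2.1)).trans_eq ?_
    simp [hS]
  set Φ : C(Icc (0 : ℝ) T, L2R) → C(Icc (0 : ℝ) T, L2R) := fun v =>
    ⟨fun t => Real.exp (-(lam * t)) • realOf (S v t), by
      have := hSc v
      fun_prop⟩ with hΦ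
  have hcontr : ContractingWith (1 / 2) Φ := by
    refine ⟨by norm_num, LipschitzWith.of_dist_le_mul fun v v' => ?_⟩
    rw [ContinuousMap.dist_le (by positivity)]
    intro t
    rw [dist_eq_norm]
    change ‖Real.exp (-(lam * t)) • realOf (S v t) - Real.exp (-(lam * t)) • realOf (S v' t)‖ ≤ _
    rw [← smul_sub, norm_smul, Real.norm_of_nonneg (Real.exp_pos _).le]
    have h1 := n2_sol_trunc_sub_le ha b 0 u₀ hR (hextc v) (hextc v') (T := T)
      (D := dist v v') dist_nonneg (fun s hs => ?_) t.2
    · have h2 := (norm_realOf_sub_le (hSm v t t.2.1) (hSm v' t t.2.1)).trans h1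
      calc _ ≤ Real.exp (-(lam * t)) * (dist v v' / 2 * Real.exp (lam * t)) := by gcongr
        _ = dist v v' / 2 * (Real.exp (-(lam * t)) * Real.exp (lam * t)) := by ring
        _ = _ := by
          rw [← Real.exp_add]
          simp
          ring
    · simp only [hext, ← smul_sub]
      rw [norm_smul, Real.norm_of_nonneg (Real.exp_pos _).le, mul_comm, ← dist_eq_norm]
      gcongr
      exact ContinuousMap.dist_apply_le_dist _
  obtain ⟨v, hv⟩ : ∃ v, Φ v = v := ⟨_, hcontr.fixedPoint_isFixedPt⟩
  refine ⟨ext v, hextc v, fun t ht => ?_⟩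
  have h1 : ext v t = realOf (S v t) := by
    have h2 : v ⟨t, ht⟩ = Real.exp (-(lam * t)) • realOf (S v t) :=
      (DFunLike.congr_fun hv ⟨t, ht⟩).symm
    simp only [hext]
    rw [projIcc_of_mem hT ht, h2, smul_smul, ← Real.exp_add, add_neg_cancel, Real.exp_zero,
      one_smul]
  rw [h1]
  exact fourierL2_realOf (hSm v t ht.1) (sol_neg a b u₀ R (ext v) t)

/-! ### Propagation of Sobolev regularity. -/

/-- The weighted `L²` norm of the Fourier transform. -/
def nw (w : ℝ → ℝ) (f : L2R) : ℝ := n2 (fun ξ => (w ξ : ℂ) * fourierL2 f ξ)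

/-- Finiteness of the weighted norm. -/
def MemW (w : ℝ → ℝ) (f : L2R) : Prop := MemLp (fun ξ => (w ξ : ℂ) * fourierL2 f ξ) 2

theorem nw_nonneg (w : ℝ → ℝ) (f : L2R) : 0 ≤ nw w f := n2_nonneg _

theorem wt_sq_mul (n : ℕ) (f : L2R) (ξ : ℝ) :
    ‖(wt n ξ : ℂ) * fourierL2 f ξ‖ ^ 2 = (1 + ξ ^ 2) ^ n * ‖fourierL2 f ξ‖ ^ 2 := by
  rw [norm_mul, (isWeight_wt n).norm_coe, mul_pow, wt, ← pow_mul, mul_comm n 2, pow_mul,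
    Real.sq_sqrt (by positivity)]

theorem normH_eq_nw (n : ℕ) (f : L2R) : normH n f = nw (wt n) f := by
  rw [normH, nw, n2]
  simp_rw [wt_sq_mul]

theorem memH_iff_memW (n : ℕ) (f : L2R) : MemH n f ↔ MemW (wt n) f := by
  rw [memH_iff_integrable, MemW, memLp_two_iff_integrable_sq_norm
    ((isWeight_wt n).aestronglyMeasurable (Lp.aestronglyMeasurable _))]
  simp_rw [wt_sq_mul]

theorem MemW.mono {w w' : ℝ → ℝ} {c c' : ℝ} (hw : IsWeight c w) (hw' : IsWeight c' w')
    (h : ∀ ξ, w ξ ≤ w' ξ) {f : L2R} (hf : MemW w' f) : MemW w f ∧ nw w f ≤ nw w' f := by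
  have hle : ∀ᵐ ξ : ℝ, ‖(w ξ : ℂ) * fourierL2 f ξ‖ ≤ ‖(w' ξ : ℂ) * fourierL2 f ξ‖ := by
    refine Eventually.of_forall fun ξ => ?_
    rw [norm_mul, norm_mul, hw.norm_coe, hw'.norm_coe]
    gcongr
    exact h ξ
  exact ⟨hf.of_le (hw.aestronglyMeasurable (Lp.aestronglyMeasurable _)) hle, n2_mono hf hle⟩

theorem IsWeight.memW_of_le {c : ℝ} {w : ℝ → ℝ} (hw : IsWeight c w) {B : ℝ} (hB : ∀ ξ, w ξ ≤ B)
    (f : L2R) : MemW w f ∧ nw w f ≤ B * ‖f‖ := by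
  have hB0 : 0 ≤ B := (hw.nonneg 0).trans (hB 0)
  have h := memLp_and_n2_le_of_le_add (F := fun ξ => (w ξ : ℂ) * fourierL2 f ξ) hB0 le_rfl
    (hw.aestronglyMeasurable (Lp.aestronglyMeasurable _)) (Lp.memLp (fourierL2 f))
    (Lp.memLp (fourierL2 f)) (Eventually.of_forall fun ξ => ?_)
  · refine ⟨h.1, ?_⟩
    have := h.2
    rw [n2_fourierL2] at this
    simpa [nw] using this
  · rw [norm_mul, hw.norm_coe, zero_mul, add_zero]
    gcongr
    exact hB ξ

theorem tendsto_wtm (n : ℕ) (ξ : ℝ) :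
    Tendsto (fun k : ℕ => wtm n (k + 1) ξ) atTop (𝓝 (wt n ξ)) := by
  refine tendsto_const_nhds.congr' ?_
  obtain ⟨K, hK⟩ := exists_nat_ge (Real.sqrt (1 + ξ ^ 2))
  filter_upwards [eventually_ge_atTop K] with k hk
  have : (K : ℝ) ≤ k := by exact_mod_cast hk
  rw [wtm, wt, min_eq_right (by linarith)]

theorem n2_eq_toReal {f : ℝ → ℂ} (hf : MemLp f 2) : n2 f = (eLpNorm f 2 volume).toReal := by
  rw [n2_eq_norm_toLp hf, Lp.norm_toLp]

/-- Fatou's lemma along the capped weights. -/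
theorem memW_wt_of_wtm_le (n : ℕ) (f : L2R) {B : ℝ} (hB : 0 ≤ B)
    (h : ∀ m : ℝ, 1 ≤ m → nw (wtm n m) f ≤ B) : MemW (wt n) f ∧ nw (wt n) f ≤ B := by
  have hm : ∀ k : ℕ, (1 : ℝ) ≤ k + 1 := fun k => by linarith [(Nat.cast_nonneg k : (0 : ℝ) ≤ k)]
  have hk : ∀ k : ℕ, eLpNorm (fun ξ => (wtm n (k + 1) ξ : ℂ) * fourierL2 f ξ) 2 volume ≤
      ENNReal.ofReal B := fun k => by
    have h1 := ((isWeight_wtm n (hm k)).memW_of_le (wtm_le n (hm k)) f).1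
    have h2 := h _ (hm k)
    rw [nw, n2_eq_toReal h1] at h2
    exact (ENNReal.le_ofReal_iff_toReal_le h1.2.ne hB).mpr h2
  have hlim := Lp.eLpNorm_lim_le_liminf_eLpNorm (p := 2) (μ := (volume : Measure ℝ))
    (f := fun (k : ℕ) ξ => (wtm n (k + 1) ξ : ℂ) * fourierL2 f ξ)
    (fun k => (isWeight_wtm n (hm k)).aestronglyMeasurable (Lp.aestronglyMeasurable _))
    (fun ξ => (wt n ξ : ℂ) * fourierL2 f ξ) (Eventually.of_forall fun ξ =>
      ((Complex.continuous_ofReal.tendsto _).comp (tendsto_wtm n ξ)).mul_const _)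
  have hle : eLpNorm (fun ξ => (wt n ξ : ℂ) * fourierL2 f ξ) 2 volume ≤ ENNReal.ofReal B :=
    hlim.trans (liminf_le_of_le (by isBoundedDefault) fun b hb => by
      obtain ⟨k, hk'⟩ := hb.exists
      exact hk'.trans (hk k))
  have hmem : MemW (wt n) f :=
    ⟨(isWeight_wt n).aestronglyMeasurable (Lp.aestronglyMeasurable _),
      hle.trans_lt ENNReal.ofReal_lt_top⟩
  refine ⟨hmem, ?_⟩
  rw [nw, n2_eq_toReal hmem]
  exact ENNReal.toReal_le_of_le_ofReal hB hle

section TruncSol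

variable {a b R T : ℝ} {u₀ : L2R} {u : ℝ → L2R}

theorem TruncSol.nw_eq (hu : TruncSol a b R T u₀ u) (w : ℝ → ℝ) {t : ℝ} (ht : t ∈ Icc 0 T) :
    nw w (u t) = n2 (fun ξ => (w ξ : ℂ) *
      sol a b (fourierL2 u₀) (fun s ξ => trunc R (u s) ξ) t ξ) := by
  refine n2_congr ?_
  filter_upwards [hu.eq t ht] with ξ hξ
  rw [hξ]

/-- If Y e^{λs} bounds the weighted norm on [0,T], the equation improves Y to ‖wû₀‖ + Y/4. Iteration
needs some finite bound to start from, here `B * M`, which is why the weight is taken bounded; the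
result does not depend on `B`. -/
theorem TruncSol.nw_le_of_bounded (ha : 0 < a) (hR : 0 < R) (hu : TruncSol a b R T u₀ u) {n : ℕ}
    {w : ℝ → ℝ} (hw : IsWeight (2 ^ n) w) {B : ℝ} (hB : ∀ ξ, w ξ ≤ B) {t : ℝ}
    (ht : t ∈ Icc 0 T) :
    nw w (u t) ≤ 2 * nw w u₀ * Real.exp ((a ^ 3 + rate n R ^ 4) * t) := by
  obtain ⟨M, hM0, hM⟩ := exists_norm_le_on_Icc (T := T) hu.continuous
  have hB0 : 0 ≤ B := (hw.nonneg 0).trans (hB 0)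
  have hy0 := nw_nonneg w u₀
  set lam := a ^ 3 + rate n R ^ 4 with hlam
  have hlam0 : 0 < lam := add_pos (pow_pos ha 3) (rate_pow_pos n hR)
  have key : ∀ k : ℕ, ∀ s ∈ Icc 0 T,
      nw w (u s) ≤ (2 * nw w u₀ + B * M / 2 ^ k) * Real.exp (lam * s) := by
    intro k
    induction k with
    | zero =>
      intro s hs
      have h1 : nw w (u s) ≤ B * M := (hw.memW_of_le hB (u s)).2.trans (by gcongr; exact hM s hs)
      rw [pow_zero, div_one]
      refine h1.trans (le_trans ?_ (le_mul_of_one_le_right (by positivity) (Real.one_le_exp ?_)))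
      · linarith
      · have := hs.1
        positivity
    | succ k ih =>
      intro s hs
      set Y := 2 * nw w u₀ + B * M / 2 ^ k with hY
      have hY0 : 0 ≤ Y := by positivity
      have h1 := (hw.sol_bound ha b (Lp.aestronglyMeasurable (fourierL2 u₀))
        (hw.memW_of_le hB u₀).1 (continuous_uncurry_trunc hR hu.continuous) hs.1
        (rate_pow_pos n hR) (Γ := 2 * 2 ^ n * R * Y) fun r hr ξ => ?_).2
      · rw [hu.nw_eq w hs]
        refine h1.trans ?_
        rw [mul_comm]
        refine mul_le_mul_of_nonneg_right ?_ (Real.exp_pos _).le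
        have h2 := mul_le_mul_of_nonneg_right (pi_mul_n2_kf_rate_le n hR) hY0
        have h3 : B * M / 2 ^ (k + 1) = B * M / 2 ^ k / 2 := by rw [pow_succ, div_div]
        have h4 : 0 ≤ B * M / 2 ^ k := by positivity
        rw [h3]
        change nw w u₀ + _ ≤ _
        have h5 : Real.pi * (2 * 2 ^ n * R * Y) * n2 (fun ξ => ((kf (rate n R ^ 4) ξ : ℝ) : ℂ)) =
          Real.pi * (4 * 2 ^ n * R) * n2 (fun ξ => ((kf (rate n R ^ 4) ξ : ℝ) : ℂ)) * Y / 2 := by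
          ring
        rw [h5]
        linarith
      · refine (hw.mul_norm_trunc_le hR (hw.memW_of_le hB (u r)).1 ξ).trans ?_
        rw [mul_assoc (2 * 2 ^ n * R)]
        exact mul_le_mul_of_nonneg_left (ih r ⟨hr.1, hr.2.trans hs.2⟩) (by positivity)
  have hlim : Tendsto (fun k : ℕ => (2 * nw w u₀ + B * M / 2 ^ k) * Real.exp (lam * t)) atTop
      (𝓝 (2 * nw w u₀ * Real.exp (lam * t))) := by
    have h1 : Tendsto (fun k : ℕ => (2 * nw w u₀ + B * M * (1 / 2 : ℝ) ^ k) * Real.exp (lam * t))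
        atTop (𝓝 ((2 * nw w u₀ + B * M * 0) * Real.exp (lam * t))) :=
      (((tendsto_pow_atTop_nhds_zero_of_lt_one (by norm_num) (by norm_num)).const_mul
        _).const_add _).mul_const _
    simpa [div_eq_mul_inv] using h1
  exact ge_of_tendsto hlim (Eventually.of_forall fun k => key k t ht)

theorem TruncSol.memW_and_nw_le (ha : 0 < a) (hR : 0 < R) (hu : TruncSol a b R T u₀ u) {n : ℕ}
    (h0 : MemW (wt n) u₀) {t : ℝ} (ht : t ∈ Icc 0 T) :
    MemW (wt n) (u t) ∧
      nw (wt n) (u t) ≤ 2 * nw (wt n) u₀ * Real.exp ((a ^ 3 + rate n R ^ 4) * t) := by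
  have := nw_nonneg (wt n) u₀
  refine memW_wt_of_wtm_le n (u t) (by positivity) fun m hm => ?_
  refine (hu.nw_le_of_bounded ha hR (isWeight_wtm n hm) (wtm_le n hm) ht).trans ?_
  have h1 := (h0.mono (isWeight_wtm n hm) (isWeight_wt n) (wtm_le_wt n hm)).2
  gcongr

theorem TruncSol.exists_mul_norm_trunc_le (ha : 0 < a) (hR : 0 < R)
    (hu : TruncSol a b R T u₀ u) {n : ℕ} (h0 : MemW (wt n) u₀) :
    ∃ Γ, 0 ≤ Γ ∧ ∀ s ∈ Icc 0 T, ∀ ξ, wt n ξ * ‖trunc R (u s) ξ‖ ≤ Γ := by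
  have h1 := nw_nonneg (wt n) u₀
  refine ⟨2 * 2 ^ n * R * (2 * nw (wt n) u₀ * Real.exp ((a ^ 3 + rate n R ^ 4) * T)),
    by positivity, fun s hs ξ => ?_⟩
  have h2 := hu.memW_and_nw_le ha hR h0 hs
  refine ((isWeight_wt n).mul_norm_trunc_le hR h2.1 ξ).trans ?_
  have h3 := rate_pow_pos n hR
  refine mul_le_mul_of_nonneg_left (h2.2.trans ?_) (by positivity)
  gcongr
  exact hs.2

theorem TruncSol.tendsto_nw_sub (ha : 0 < a) (hR : 0 < R) (hu : TruncSol a b R T u₀ u) {n : ℕ}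
    (h0 : MemW (wt n) u₀) {t : ℝ} (ht : t ∈ Icc 0 T) :
    Tendsto (fun s => nw (wt n) (u s - u t)) (𝓝[Icc 0 T] t) (𝓝 0) := by
  obtain ⟨Γ, -, hΓ⟩ := hu.exists_mul_norm_trunc_le ha hR h0
  refine ((isWeight_wt n).tendsto_n2_sol_sub ha b (Lp.aestronglyMeasurable (fourierL2 u₀)) h0
    (continuous_uncurry_trunc hR hu.continuous) ht hΓ).congr' ?_
  filter_upwards [self_mem_nhdsWithin] with s hs
  refine n2_congr ?_
  rw [fourierL2_sub]
  filter_upwards [Lp.coeFn_sub (fourierL2 (u s)) (fourierL2 (u t)), hu.eq t ht, hu.eq s hs]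
    with ξ e1 e2 e3
  rw [e1, Pi.sub_apply, e2, e3]

end TruncSol

/-! ### Orthogonality of the flux and the energy estimate. -/

theorem wt_one_mul_kf_one (ξ : ℝ) : wt 1 ξ * kf 1 ξ = 1 := by
  have := one_le_bracket ξ
  rw [wt, kf, pow_one, add_comm (ξ ^ 2)]
  exact mul_inv_cancel₀ (by positivity)

theorem wt_mono {m n : ℕ} (h : m ≤ n) (ξ : ℝ) : wt m ξ ≤ wt n ξ :=
  pow_le_pow_right₀ (one_le_bracket ξ) h

theorem abs_le_wt {n : ℕ} (hn : 1 ≤ n) (ξ : ℝ) : |ξ| ≤ wt n ξ := by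
  refine le_trans ?_ (wt_mono hn ξ)
  rw [wt, pow_one]
  exact Real.abs_le_sqrt (by linarith)

/-- The role of n ≥ 1: a weighted L² bound becomes integrability of the transform, because the
inverse of the first weight is itself square integrable. -/
theorem le_kf_mul_of_wt_mul_le {n : ℕ} (hn : 1 ≤ n) {x B ξ : ℝ} (hx : 0 ≤ x)
    (h : wt n ξ * x ≤ B) : x ≤ kf 1 ξ * B := by
  have h1 : wt 1 ξ * x ≤ B := (mul_le_mul_of_nonneg_right (wt_mono hn ξ) hx).trans h
  calc x = kf 1 ξ * (wt 1 ξ * x) := by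
        rw [← mul_assoc, mul_comm (kf 1 ξ), wt_one_mul_kf_one, one_mul]
    _ ≤ _ := mul_le_mul_of_nonneg_left h1 (kf_nonneg _ _)

theorem integrable_kf_mul {B : ℝ → ℝ} (hB : MemLp B 2) : Integrable fun ξ => kf 1 ξ * B ξ := by
  have h : MemLp (kf 1) 2 := by simpa only [norm_kf] using (memLp_kf one_pos).norm
  exact h.integrable_mul hB

theorem MemW.integrable {n : ℕ} (hn : 1 ≤ n) {f : L2R} (hf : MemW (wt n) f) :
    Integrable (fourierL2 f) := by
  refine (integrable_kf_mul hf.norm).mono' (Lp.aestronglyMeasurable _)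
    (Eventually.of_forall fun ξ => ?_)
  refine le_kf_mul_of_wt_mul_le hn (norm_nonneg _) ?_
  rw [norm_mul, (isWeight_wt n).norm_coe]

/-- The flux `∂ₓ(f²)` is orthogonal to `f`, on the Fourier side. -/
theorem integral_mul_fourierMul_self {f : L2R} (hf : MemW (wt 1) f) :
    ∫ ξ : ℝ, (ξ : ℂ) * fourierMul f f ξ * starRingEnd ℂ (fourierL2 f ξ) = 0 := by
  set F : ℝ → ℂ := ((fourierL2 f : L2C) : ℝ → ℂ) with hF
  have hFm : Measurable F := (Lp.stronglyMeasurable (fourierL2 f)).measurable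
  have hF2 : MemLp F 2 := Lp.memLp _
  have hF1 : Integrable F := hf.integrable le_rfl
  set cj := starRingEnd ℂ with hcj
  have hcjm : Measurable cj := Complex.continuous_conj.measurable
  set G : ℝ × ℝ → ℂ := fun p => (p.1 : ℂ) * cj (F p.1) * cj (F p.2) * F (p.2 + p.1) with hG
  have hGm : Measurable G := by
    have h1 : Measurable fun p : ℝ × ℝ => F p.1 := hFm.comp measurable_fst
    have h2 : Measurable fun p : ℝ × ℝ => F p.2 := hFm.comp measurable_snd
    have h3 : Measurable fun p : ℝ × ℝ => F (p.2 + p.1) :=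
      hFm.comp (measurable_snd.add measurable_fst)
    exact (((Complex.measurable_ofReal.comp measurable_fst).mul (hcjm.comp h1)).mul
      (hcjm.comp h2)).mul h3
  have hGn : ∀ p, ‖G p‖ = |p.1| * ‖F p.1‖ * (‖F p.2‖ * ‖F (p.2 + p.1)‖) := fun p => by
    simp only [hG, norm_mul, hcj, RCLike.norm_conj, Complex.norm_real, Real.norm_eq_abs]
    ring
  have hshift : ∀ ξ, MemLp (fun η => F (η + ξ)) 2 := fun ξ =>
    hF2.comp_measurePreserving (measurePreserving_add_right (volume : Measure ℝ) ξ)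
  have hGi : Integrable G (volume.prod volume) := by
    rw [integrable_prod_iff hGm.aestronglyMeasurable]
    constructor
    · refine Eventually.of_forall fun ξ => ?_
      have hs : Measurable fun η => G (ξ, η) := hGm.comp measurable_prodMk_left
      rw [← integrable_norm_iff hs.aestronglyMeasurable]
      simp only [hGn]
      exact (integrable_norm_mul hF2 (hshift ξ)).const_mul _
    · refine (hF1.norm.const_mul (2 * 2 ^ 1 * ‖f‖ * nw (wt 1) f)).mono'
        hGm.aestronglyMeasurable.norm.integral_prod_right' (Eventually.of_forall fun ξ => ?_)
      simp only [hGn]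
      rw [integral_const_mul, Real.norm_of_nonneg (mul_nonneg (by positivity)
        (integral_nonneg fun _ => by positivity))]
      have h1 := (isWeight_wt 1).mul_integral_le hf ξ
      have h2 := abs_le_wt le_rfl ξ
      have h3 : 0 ≤ ∫ η, ‖F η‖ * ‖F (η + ξ)‖ := integral_nonneg fun _ => by positivity
      calc |ξ| * ‖F ξ‖ * ∫ η, ‖F η‖ * ‖F (η + ξ)‖
          = (|ξ| * ∫ η, ‖F η‖ * ‖F (η + ξ)‖) * ‖F ξ‖ := by ring
        _ ≤ (wt 1 ξ * ∫ η, ‖F η‖ * ‖F (η + ξ)‖) * ‖F ξ‖ := by gcongr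
        _ ≤ _ := mul_le_mul_of_nonneg_right h1 (norm_nonneg _)
  have hI : ∫ ξ : ℝ, (ξ : ℂ) * fourierMul f f ξ * cj (F ξ) = ∫ p, G p ∂(volume.prod volume) := by
    rw [integral_prod _ hGi]
    refine integral_congr_ae (Eventually.of_forall fun ξ => ?_)
    simp only [hG, fourierMul_eq_integral, mul_assoc]
    rw [integral_const_mul, integral_const_mul]
    ring
  rw [hI]
  set I := ∫ p, G p ∂(volume.prod volume) with hIdef
  have hswap : ∫ p : ℝ × ℝ, G p.swap ∂(volume.prod volume) = I := integral_prod_swap G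
  -- Exchanging the two frequencies and adding replaces the factor ξ by ξ + η.
  have h2I : I + I = ∫ p : ℝ × ℝ, G p + G p.swap ∂(volume.prod volume) := by
    have hGs : Integrable (fun p : ℝ × ℝ => G p.swap) (volume.prod volume) := hGi.swap
    rw [integral_add hGi hGs, hswap]
  -- The substitution (ξ, η) ↦ (ξ + η, -ξ), together with F(-ξ) = conj F(ξ), turns the conjugate
  -- integrand into this symmetrized one. Taking norms in conj I = 2I forces I = 0.
  have hconj : cj I = I + I := by
    have he := measurePreserving_add_prod_neg (volume : Measure ℝ) (volume : Measure ℝ)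
    have h1 : ∫ p, cj (G p) ∂(volume.prod volume) =
        ∫ p : ℝ × ℝ, cj (G (p.2 + p.1, -p.1)) ∂(volume.prod volume) := by
      have := integral_map (μ := (volume : Measure ℝ).prod (volume : Measure ℝ))
        he.measurable.aemeasurable
        (f := fun p => cj (G p)) (hcjm.comp hGm).aestronglyMeasurable
      rw [he.map_eq] at this
      exact this
    rw [h2I, hIdef, ← integral_conj, h1]
    refine integral_congr_ae ?_
    have hneg := Measure.quasiMeasurePreserving_fst (μ := (volume : Measure ℝ))
      (ν := (volume : Measure ℝ)) |>.ae (fourierL2_neg_eq_conj f)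
    filter_upwards [hneg] with p hp
    simp only [hG, Prod.fst_swap, Prod.snd_swap, map_mul, hcj, Complex.conj_conj,
      Complex.conj_ofReal]
    rw [show -p.1 + (p.2 + p.1) = p.2 by ring, add_comm p.1 p.2]
    change _ * fourierL2 f (-p.1) * _ = _
    rw [hp]
    push_cast
    ring
  have hn : ‖I‖ = 2 * ‖I‖ := by
    have h1 : ‖cj I‖ = ‖I‖ := RCLike.norm_conj I
    rw [hconj, ← two_mul, norm_mul, Complex.norm_two] at h1
    exact h1.symm
  exact norm_eq_zero.mp (by linarith)

theorem fourierMul_smul_self (c : ℝ) (f : L2R) (ξ : ℝ) :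
    fourierMul (c • f) (c • f) ξ = (c : ℂ) ^ 2 * fourierMul f f ξ := by
  rw [fourierMul, fourierMul, Real.fourier_real_eq, Real.fourier_real_eq, ← integral_const_mul]
  refine integral_congr_ae ?_
  filter_upwards [Lp.coeFn_smul c f] with x hx
  rw [hx, Pi.smul_apply, smul_eq_mul, Circle.smul_def, Circle.smul_def, smul_eq_mul, smul_eq_mul]
  push_cast
  ring

/-- The truncation is radial, so it only multiplies the flux by a scalar and the orthogonality
survives. -/
theorem integral_mul_trunc (R : ℝ) {f : L2R} (hf : MemW (wt 1) f) :
    ∫ ξ : ℝ, (ξ : ℂ) * trunc R f ξ * starRingEnd ℂ (fourierL2 f ξ) = 0 := by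
  simp only [trunc, retr, fourierMul_smul_self]
  have := congrArg (((R / max R ‖f‖ : ℝ) : ℂ) ^ 2 * ·) (integral_mul_fourierMul_self hf)
  simp only [mul_zero] at this
  rw [← integral_const_mul] at this
  rw [← this]
  refine integral_congr_ae (Eventually.of_forall fun ξ => ?_)
  ring

/-- The source of the energy balance at one frequency. -/
def energySource (a b : ℝ) (c : ℝ → ℂ) (g : ℝ → ℝ → ℂ) (s ξ : ℝ) : ℝ :=
  -2 * Real.exp (-2 * a ^ 3 * s) *
    (Real.pi * Complex.I * ξ * g s ξ * starRingEnd ℂ (sol a b c g s ξ)).re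

/-- The factor e^{-2a³s} compensates the worst growth Re ψ ≥ -a³, so in the derivative of
e^{-2a³s}|U|² only the source can be positive. -/
theorem norm_sol_sq_le {a : ℝ} (ha : 0 < a) (b : ℝ) (c : ℝ → ℂ) {g : ℝ → ℝ → ℂ} {ξ t : ℝ}
    (hg : Continuous fun s => g s ξ) (ht : 0 ≤ t) :
    Real.exp (-2 * a ^ 3 * t) * ‖sol a b c g t ξ‖ ^ 2 ≤
      ‖c ξ‖ ^ 2 + ∫ s in (0 : ℝ)..t, energySource a b c g s ξ := by
  have hU : Continuous fun s => sol a b c g s ξ := continuous_sol_left a b c hg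
  set N' : ℝ → ℝ := fun s => Real.exp (-2 * a ^ 3 * s) * (-2 * a ^ 3) * ‖sol a b c g s ξ‖ ^ 2 +
    Real.exp (-2 * a ^ 3 * s) * (2 * inner ℝ (sol a b c g s ξ)
      (-psi a b ξ * sol a b c g s ξ - Real.pi * Complex.I * ξ * g s ξ)) with hN'
  have hder : ∀ s, HasDerivAt (fun s => Real.exp (-2 * a ^ 3 * s) * ‖sol a b c g s ξ‖ ^ 2)
      (N' s) s := fun s => by
    have h1 : HasDerivAt (fun s : ℝ => -2 * a ^ 3 * s) (-2 * a ^ 3) s := by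
      simpa only [id, mul_one] using (hasDerivAt_id s).const_mul (-2 * a ^ 3)
    exact h1.exp.mul (hasDerivAt_sol a b c hg s).norm_sq
  have hN'c : Continuous N' := by
    simp only [hN']
    fun_prop
  have hq : Continuous fun s => energySource a b c g s ξ := by
    unfold energySource
    have h1 : Continuous fun s => starRingEnd ℂ (sol a b c g s ξ) :=
      Complex.continuous_conj.comp hU
    have h2 : Continuous fun s : ℝ => -2 * Real.exp (-2 * a ^ 3 * s) := by fun_prop
    exact h2.mul (Complex.continuous_re.comp ((continuous_const.mul hg).mul h1))
  have hFTC := intervalIntegral.integral_eq_sub_of_hasDerivAt (a := 0) (b := t)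
    (fun s _ => hder s) (hN'c.intervalIntegrable 0 t)
  have hle : ∫ s in (0 : ℝ)..t, N' s ≤ ∫ s in (0 : ℝ)..t, energySource a b c g s ξ := by
    refine intervalIntegral.integral_mono_on ht (hN'c.intervalIntegrable 0 t)
      (hq.intervalIntegrable 0 t) fun s _ => ?_
    have h1 := le_psi_re ha b ξ
    set U := sol a b c g s ξ with hUs
    have h2 : inner ℝ U (-psi a b ξ * U - Real.pi * Complex.I * ξ * g s ξ) =
        -(psi a b ξ).re * ‖U‖ ^ 2 -
          (Real.pi * Complex.I * ξ * g s ξ * starRingEnd ℂ U).re := by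
      rw [Complex.inner, ← Complex.normSq_eq_norm_sq, sub_mul, Complex.sub_re,
        mul_assoc (-psi a b ξ), Complex.mul_conj, Complex.re_mul_ofReal, Complex.neg_re]
    simp only [hN', energySource, h2, ← hUs]
    have h3 := Real.exp_pos (-2 * a ^ 3 * s)
    have h4 : 0 ≤ Real.exp (-2 * a ^ 3 * s) * ‖U‖ ^ 2 * (a ^ 3 + (psi a b ξ).re) :=
      mul_nonneg (by positivity) (by nlinarith [sq_nonneg ξ])
    nlinarith
  simp only [mul_zero, Real.exp_zero, one_mul, sol_zero] at hFTC
  linarith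

/-- Integrating the pointwise balance over all frequencies makes the source vanish at each time, by
`integral_mul_trunc`. The bound does not involve `R`, so `R` can be chosen above it. The H¹ datum
provides the integrability for exchanging the integrals. -/
theorem TruncSol.norm_le {a b R T : ℝ} {u₀ : L2R} {u : ℝ → L2R} (ha : 0 < a) (hR : 0 < R)
    (hu : TruncSol a b R T u₀ u) (h0 : MemW (wt 1) u₀) {t : ℝ} (ht : t ∈ Icc 0 T) :
    ‖u t‖ ≤ Real.exp (a ^ 3 * t) * ‖u₀‖ := by
  obtain ⟨Γ, hΓ0, hΓ⟩ := hu.exists_mul_norm_trunc_le ha hR h0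
  obtain ⟨B, hB2, hB⟩ := (isWeight_wt 1).exists_sol_dominated ha b h0 hΓ
  set c : ℝ → ℂ := ((fourierL2 u₀ : L2C) : ℝ → ℂ) with hc
  set g : ℝ → ℝ → ℂ := fun s ξ => trunc R (u s) ξ with hg
  have hgc : Continuous (Function.uncurry g) := continuous_uncurry_trunc hR hu.continuous
  have hg1 : ∀ ξ, Continuous fun s => g s ξ := fun ξ =>
    hgc.comp (f := fun s => (s, ξ)) (by fun_prop)
  have hBi := integrable_kf_mul hB2
  have hUB : ∀ s ∈ Icc 0 T, ∀ ξ, ‖sol a b c g s ξ‖ ≤ kf 1 ξ * B ξ := fun s hs ξ => by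
    refine le_kf_mul_of_wt_mul_le le_rfl (norm_nonneg _) ?_
    have := hB s hs ξ
    rwa [norm_mul, (isWeight_wt 1).norm_coe] at this
  have hUm : Measurable (Function.uncurry (sol a b c g)) := by
    have h1 : Measurable c := (Lp.stronglyMeasurable (fourierL2 u₀)).measurable
    have h2 := (continuous_duh a b hgc).measurable
    have h3 := (continuous_psi a b).measurable
    have h4 : Function.uncurry (sol a b c g) = fun p : ℝ × ℝ =>
      Complex.exp (-(p.1 : ℂ) * psi a b p.2) * c p.2 -
        Real.pi * Complex.I * p.2 * Function.uncurry (duh a b g) p := rfl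
    rw [h4]
    fun_prop
  set h : ℝ → ℝ → ℂ := fun s ξ =>
    Real.pi * Complex.I * ξ * g s ξ * starRingEnd ℂ (sol a b c g s ξ) with hh
  have hhm : Measurable (Function.uncurry h) := by
    have h1 : Measurable fun p => starRingEnd ℂ (Function.uncurry (sol a b c g) p) :=
      Complex.continuous_conj.measurable.comp hUm
    have h2 := hgc.measurable
    have h4 : Function.uncurry h = fun p : ℝ × ℝ =>
      (Real.pi * Complex.I * p.2 * Function.uncurry g p) *
        starRingEnd ℂ (Function.uncurry (sol a b c g) p) := rfl
    rw [h4]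
    have h5 : Measurable fun p : ℝ × ℝ => (Real.pi * Complex.I * p.2 : ℂ) := by fun_prop
    exact (h5.mul h2).mul h1
  have hqm : Measurable (Function.uncurry (energySource a b c g)) := by
    have h5 : Measurable fun p : ℝ × ℝ => Real.exp (-2 * a ^ 3 * p.1) := by fun_prop
    exact (h5.const_mul (-2)).mul (Complex.measurable_re.comp hhm)
  have hhb : ∀ s ∈ Icc 0 T, ∀ ξ, ‖h s ξ‖ ≤ Real.pi * Γ * (kf 1 ξ * B ξ) := by
    intro s hs ξ
    have h2 : |ξ| * ‖g s ξ‖ ≤ Γ :=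
      (mul_le_mul_of_nonneg_right (abs_le_wt le_rfl ξ) (norm_nonneg _)).trans (hΓ s hs ξ)
    have h4 := hUB s hs ξ
    have h5 := Real.pi_pos
    have h3 : ‖h s ξ‖ = Real.pi * (|ξ| * ‖g s ξ‖) * ‖sol a b c g s ξ‖ := by
      simp only [hh]
      rw [norm_mul, norm_mul, norm_mul, norm_mul, Complex.norm_I, RCLike.norm_conj,
        Complex.norm_real, Complex.norm_real, Real.norm_of_nonneg Real.pi_pos.le, mul_one,
        Real.norm_eq_abs, mul_assoc Real.pi]
    rw [h3]
    gcongr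
  have hqb : ∀ s ∈ Icc 0 T, ∀ ξ, ‖energySource a b c g s ξ‖ ≤
      2 * (Real.pi * Γ * (kf 1 ξ * B ξ)) := by
    intro s hs ξ
    have h1 : Real.exp (-2 * a ^ 3 * s) ≤ 1 := by
      refine Real.exp_le_one_iff.mpr ?_
      have := mul_nonneg (pow_pos ha 3).le hs.1
      linarith
    have h3 := (Complex.abs_re_le_norm (h s ξ)).trans (hhb s hs ξ)
    rw [energySource, norm_mul, norm_mul, Real.norm_of_nonneg (Real.exp_pos _).le,
      Real.norm_eq_abs, Real.norm_eq_abs, abs_neg, abs_two]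
    have h4 := abs_nonneg (h s ξ).re
    have h5 := Real.exp_pos (-2 * a ^ 3 * s)
    change 2 * Real.exp (-2 * a ^ 3 * s) * |(h s ξ).re| ≤ _
    nlinarith
  have hqi : Integrable (Function.uncurry (energySource a b c g))
      ((volume.restrict (Ioc 0 t)).prod volume) := by
    have h1 : Integrable (fun _ : ℝ => (1 : ℝ)) (volume.restrict (Ioc 0 t)) :=
      integrable_const _
    have h2 := h1.mul_prod ((hBi.const_mul (Real.pi * Γ)).const_mul 2)
    refine h2.mono' hqm.aestronglyMeasurable ?_
    have h3 : ∀ᵐ s ∂(volume.restrict (Ioc 0 t)), s ∈ Icc 0 T := by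
      filter_upwards [ae_restrict_mem measurableSet_Ioc] with s hs
      exact ⟨hs.1.le, hs.2.trans ht.2⟩
    have h4 := Measure.quasiMeasurePreserving_fst (μ := volume.restrict (Ioc 0 t))
      (ν := (volume : Measure ℝ)) |>.ae h3
    filter_upwards [h4] with p hp
    rw [one_mul]
    exact hqb p.1 hp p.2
  have hswap : ∫ ξ, ∫ s in (0 : ℝ)..t, energySource a b c g s ξ = 0 := by
    simp_rw [intervalIntegral.integral_of_le ht.1]
    rw [← integral_integral_swap hqi]
    refine integral_eq_zero_of_ae ?_
    filter_upwards [ae_restrict_mem measurableSet_Ioc] with s hs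
    have hsT : s ∈ Icc 0 T := ⟨hs.1.le, hs.2.trans ht.2⟩
    have h1 := integral_mul_trunc R (hu.memW_and_nw_le ha hR h0 hsT).1
    have h2 : Integrable (h s) := (hBi.const_mul (Real.pi * Γ)).mono'
      (hhm.comp measurable_prodMk_left).aestronglyMeasurable
      (Eventually.of_forall fun ξ => hhb s hsT ξ)
    have h3 : ∫ ξ, h s ξ = 0 := by
      have h4 := congrArg ((Real.pi * Complex.I : ℂ) * ·) h1
      simp only [mul_zero] at h4
      rw [← integral_const_mul] at h4
      rw [← h4]
      refine integral_congr_ae ?_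
      filter_upwards [hu.eq s hsT] with ξ hξ
      rw [hξ]
      simp only [hh]
      ring
    have h5 : ∫ ξ, (h s ξ).re = 0 := by
      have := integral_re h2
      rw [h3] at this
      exact this
    have h6 : ∀ ξ, energySource a b c g s ξ = -2 * Real.exp (-2 * a ^ 3 * s) * (h s ξ).re :=
      fun ξ => rfl
    simp_rw [h6]
    rw [integral_const_mul, h5, mul_zero]
    rfl
  have hint1 : Integrable fun ξ => ‖sol a b c g t ξ‖ ^ 2 :=
    (memLp_two_iff_integrable_sq_norm (memLp_sol ha b u₀ hR hu.continuous ht.1).1).mp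
      (memLp_sol ha b u₀ hR hu.continuous ht.1)
  have hint2 : Integrable fun ξ => ‖c ξ‖ ^ 2 :=
    (memLp_two_iff_integrable_sq_norm (Lp.memLp (fourierL2 u₀)).1).mp (Lp.memLp (fourierL2 u₀))
  have hint3 : Integrable fun ξ => ∫ s in (0 : ℝ)..t, energySource a b c g s ξ := by
    simp_rw [intervalIntegral.integral_of_le ht.1]
    exact hqi.integral_prod_right
  have hfin := integral_mono (hint1.const_mul (Real.exp (-2 * a ^ 3 * t))) (hint2.add hint3)
    fun ξ => norm_sol_sq_le ha b c (hg1 ξ) ht.1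
  rw [integral_const_mul, integral_add' hint2 hint3, hswap, add_zero, ← n2_sq, ← n2_sq,
    ← n2_congr (hu.eq t ht), hc, n2_fourierL2, n2_fourierL2] at hfin
  have h1 : ‖u t‖ ^ 2 ≤ (Real.exp (a ^ 3 * t) * ‖u₀‖) ^ 2 := by
    have h2 : Real.exp (-2 * a ^ 3 * t) * Real.exp (a ^ 3 * t) ^ 2 = 1 := by
      rw [← Real.exp_nat_mul, ← Real.exp_add]
      norm_num
      ring
    have h3 := mul_le_mul_of_nonneg_left hfin (sq_nonneg (Real.exp (a ^ 3 * t)))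
    calc ‖u t‖ ^ 2 = (Real.exp (-2 * a ^ 3 * t) * Real.exp (a ^ 3 * t) ^ 2) * ‖u t‖ ^ 2 := by
          rw [h2, one_mul]
      _ = Real.exp (a ^ 3 * t) ^ 2 * (Real.exp (-2 * a ^ 3 * t) * ‖u t‖ ^ 2) := by ring
      _ ≤ _ := h3.trans_eq (by ring)
  exact le_of_sq_le_sq h1 (by positivity)

/-! ### Back to physical space: kernels and the Duhamel formula. -/

/-- The multiplier `e^{-tψ}`. -/
def heat (a b t ξ : ℝ) : ℂ := Complex.exp (-(t : ℂ) * psi a b ξ)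

theorem continuous_heat (a b t : ℝ) : Continuous (heat a b t) := by
  have := continuous_psi a b
  unfold heat
  fun_prop

theorem integrable_heat {a : ℝ} (ha : 0 < a) (b : ℝ) {t : ℝ} (ht : 0 < t) :
    Integrable (heat a b t) :=
  ((integrable_exp_neg_mul_sq ht).const_mul (Real.exp (a ^ 3 * t))).mono'
    (continuous_heat a b t).aestronglyMeasurable
    (Eventually.of_forall fun ξ => norm_exp_psi_le ha b ht.le ξ)

theorem integrable_mul_heat {a : ℝ} (ha : 0 < a) (b : ℝ) {t : ℝ} (ht : 0 < t) :
    Integrable fun ξ : ℝ => (ξ : ℂ) * heat a b t ξ := by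
  refine ((integrable_mul_exp_neg_mul_sq ht).norm.const_mul (Real.exp (a ^ 3 * t))).mono'
    (Complex.continuous_ofReal.mul (continuous_heat a b t)).aestronglyMeasurable
    (Eventually.of_forall fun ξ => ?_)
  rw [norm_mul, norm_mul, Complex.norm_real, Real.norm_of_nonneg (Real.exp_pos _).le,
    mul_left_comm]
  exact mul_le_mul_of_nonneg_left (norm_exp_psi_le ha b ht.le ξ) (norm_nonneg _)

theorem memLp_heat {a : ℝ} (ha : 0 < a) (b : ℝ) {t : ℝ} (ht : 0 < t) : MemLp (heat a b t) 2 := by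
  rw [memLp_two_iff_integrable_sq_norm (continuous_heat a b t).aestronglyMeasurable]
  refine ((integrable_heat ha b ht).norm.const_mul (Real.exp (a ^ 3 * t))).mono'
    ((continuous_heat a b t).norm.pow 2).aestronglyMeasurable (Eventually.of_forall fun ξ => ?_)
  rw [norm_pow, norm_norm, sq]
  exact mul_le_mul_of_nonneg_right (norm_exp_psi_le' ha b ht.le ξ) (norm_nonneg _)

theorem K_eq (a b t : ℝ) : K a b t = 𝓕⁻ (heat a b t) := rfl

theorem deriv_fourierInv {f : ℝ → ℂ} (hf : Integrable f)
    (hf' : Integrable fun ξ : ℝ => (ξ : ℂ) * f ξ) :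
    deriv (𝓕⁻ f) = 𝓕⁻ (fun ξ : ℝ => (2 * Real.pi * Complex.I * ξ : ℂ) * f ξ) := by
  rw [Real.fourierInv_eq_fourier_comp_neg, Real.fourierInv_eq_fourier_comp_neg,
    Real.deriv_fourier hf.comp_neg]
  · congr 1
    ext ξ
    push_cast
    rw [smul_eq_mul]
    ring
  · refine hf'.comp_neg.neg.congr (Eventually.of_forall fun ξ => ?_)
    simp

theorem dxK_eq {a : ℝ} (ha : 0 < a) (b : ℝ) {t : ℝ} (ht : 0 < t) :
    dxK a b t = 𝓕⁻ (fun ξ : ℝ => (2 * Real.pi * Complex.I * ξ : ℂ) * heat a b t ξ) := by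
  rw [dxK, K_eq, deriv_fourierInv (integrable_heat ha b ht) (integrable_mul_heat ha b ht)]

theorem conv_dxK_sq {a : ℝ} (ha : 0 < a) (b : ℝ) {t : ℝ} (ht : 0 < t) (f : L2R) (x : ℝ) :
    conv (dxK a b t) (fun y => f y ^ 2) x =
      𝓕⁻ (fun ξ : ℝ => (2 * Real.pi * Complex.I * ξ : ℂ) * heat a b t ξ * fourierMul f f ξ) x := by
  have h1 : Integrable fun ξ : ℝ => (2 * Real.pi * Complex.I * ξ : ℂ) * heat a b t ξ := by
    simpa only [mul_assoc] using
      (integrable_mul_heat ha b ht).const_mul (2 * Real.pi * Complex.I : ℂ)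
  rw [dxK_eq ha b ht]
  simp_rw [sq]
  rw [conv_fourierInv_L1 h1 (integrable_mul_real f f)]
  rfl

theorem fourierInv_real_eq (f : ℝ → ℂ) (x : ℝ) :
    𝓕⁻ f x = ∫ ξ, (Real.fourierChar (ξ * x) : ℂ) * f ξ := by
  rw [Real.fourierInv_eq]
  refine integral_congr_ae (Eventually.of_forall fun ξ => ?_)
  simp only [Circle.smul_def, smul_eq_mul]
  congr 3
  simp [mul_comm]

/-- Justifies Fubini. Integrating in time first gains |ξ|/(ξ²+1) ≤ `kf 1 ξ`, the weight on the
source supplies a second factor `kf 1 ξ`, and their product is integrable. -/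
theorem integrable_duhamel_prod {a : ℝ} (ha : 0 < a) (b : ℝ) {g : ℝ → ℝ → ℂ}
    (hg : Continuous (Function.uncurry g)) {n : ℕ} (hn : 1 ≤ n) {t Γ : ℝ} (ht : 0 ≤ t)
    (hΓ : ∀ s ∈ Icc 0 t, ∀ ξ, wt n ξ * ‖g s ξ‖ ≤ Γ) :
    Integrable (fun p : ℝ × ℝ => (p.2 : ℂ) * heat a b (t - p.1) p.2 * g p.1 p.2)
      ((volume.restrict (Ioc 0 t)).prod volume) := by
  have hc : Continuous fun p : ℝ × ℝ => (p.2 : ℂ) * heat a b (t - p.1) p.2 * g p.1 p.2 := by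
    have h1 := continuous_psi a b
    have h2 : Continuous fun p : ℝ × ℝ => g p.1 p.2 := hg
    unfold heat
    fun_prop
  rw [integrable_prod_iff' hc.aestronglyMeasurable]
  have hΓ0 : 0 ≤ Γ :=
    (mul_nonneg ((isWeight_wt n).nonneg 0) (norm_nonneg _)).trans (hΓ 0 ⟨le_rfl, ht⟩ 0)
  constructor
  · refine Eventually.of_forall fun ξ => ?_
    have h1 : Continuous fun s : ℝ => (ξ : ℂ) * heat a b (t - s) ξ * g s ξ :=
      hc.comp (f := fun s => (s, ξ)) (by fun_prop)
    exact (h1.integrableOn_Icc (a := 0) (b := t)).mono_set Ioc_subset_Icc_self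
  · have hk : MemLp (kf 1) 2 := by simpa only [norm_kf] using (memLp_kf one_pos).norm
    have hkk : Integrable fun ξ => kf 1 ξ * kf 1 ξ := hk.integrable_mul hk
    refine (hkk.const_mul (Γ * Real.exp ((a ^ 3 + 1) * t))).mono' ?_
      (Eventually.of_forall fun ξ => ?_)
    · exact (hc.aestronglyMeasurable (μ := (volume.restrict (Ioc 0 t)).prod
        volume)).norm.prod_swap.integral_prod_right'
    · have hgk : ∀ s ∈ Icc 0 t, ‖g s ξ‖ ≤ kf 1 ξ * Γ * Real.exp ((a ^ 3 + 1) * s) := by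
        intro s hs
        refine (le_kf_mul_of_wt_mul_le hn (norm_nonneg _) (hΓ s hs ξ)).trans
          (le_mul_of_one_le_right (mul_nonneg (kf_nonneg _ _) hΓ0) (Real.one_le_exp ?_))
        have := hs.1
        positivity
      obtain ⟨F, hF, hle, hint⟩ := exists_duh_majorant ha b ht one_pos hgk
      have h1 : ∀ s, ‖(ξ : ℂ) * heat a b (t - s) ξ * g s ξ‖ =
          |ξ| * ‖Complex.exp (-((t - s : ℝ) : ℂ) * psi a b ξ) * g s ξ‖ := fun s => by
        rw [mul_assoc, norm_mul, Complex.norm_real, Real.norm_eq_abs]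
        rfl
      simp only [h1]
      rw [integral_const_mul, Real.norm_of_nonneg (mul_nonneg (abs_nonneg _)
        (integral_nonneg fun _ => norm_nonneg _)), ← intervalIntegral.integral_of_le ht]
      have h2 : ∫ s in (0 : ℝ)..t, ‖Complex.exp (-((t - s : ℝ) : ℂ) * psi a b ξ) * g s ξ‖ ≤
          ∫ s in (0 : ℝ)..t, F s := by
        have h3 : Continuous fun s : ℝ => g s ξ := hg.comp (f := fun s => (s, ξ)) (by fun_prop)
        refine intervalIntegral.integral_mono_on ht (Continuous.intervalIntegrable ?_ _ _)
          (hF.intervalIntegrable _ _) hle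
        fun_prop
      have h4 := abs_div_le_kf one_pos ξ
      calc _ ≤ |ξ| * (kf 1 ξ * Γ * Real.exp ((a ^ 3 + 1) * t) / (ξ ^ 2 + 1)) :=
            mul_le_mul_of_nonneg_left (h2.trans hint) (abs_nonneg _)
        _ = Γ * Real.exp ((a ^ 3 + 1) * t) * (kf 1 ξ * (|ξ| / (ξ ^ 2 + 1))) := by ring
        _ ≤ _ := by
          have := kf_nonneg 1 ξ
          gcongr

/-- The right-hand side of the Duhamel formula is an inverse Fourier transform. -/
theorem duhamel_rhs_eq {a : ℝ} (ha : 0 < a) (b : ℝ) (u₀ : L2R) {u : ℝ → L2R}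
    (hu : Continuous u) {n : ℕ} (hn : 1 ≤ n) {t Γ : ℝ} (ht : 0 < t)
    (hΓ : ∀ s ∈ Icc 0 t, ∀ ξ, wt n ξ * ‖fourierMul (u s) (u s) ξ‖ ≤ Γ) (x : ℝ) :
    conv (K a b t) u₀ x
      - (1 / 2) * ∫ s in (0 : ℝ)..t, conv (dxK a b (t - s)) (fun y => (u s y) ^ 2) x =
    𝓕⁻ (sol a b (fourierL2 u₀) (fun s ξ => fourierMul (u s) (u s) ξ) t) x := by
  set g : ℝ → ℝ → ℂ := fun s ξ => fourierMul (u s) (u s) ξ with hg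
  have hgc : Continuous (Function.uncurry g) := by
    have h : Continuous fun p : ℝ × ℝ => (u p.1, p.2) :=
      (hu.comp continuous_fst).prodMk continuous_snd
    have h2 := continuous_fourierMul_self.comp h
    refine h2.congr ?_
    rintro ⟨s, ξ⟩
    rfl
  have hprod := integrable_duhamel_prod ha b hgc hn ht.le hΓ
  set e : ℝ → ℂ := fun ξ => (Real.fourierChar (ξ * x) : ℂ) with he
  have hec : Continuous e := continuous_fourierChar_mul x
  have hen : ∀ ξ, ‖e ξ‖ ≤ 1 := fun ξ => (Circle.norm_coe _).le
  have hprod2 : Integrable (Function.uncurry fun s ξ : ℝ =>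
      e ξ * ((2 * Real.pi * Complex.I * ξ : ℂ) * heat a b (t - s) ξ * g s ξ))
      ((volume.restrict (Ioc 0 t)).prod volume) := by
    have h1 : Integrable (fun p : ℝ × ℝ => e p.2 *
        ((p.2 : ℂ) * heat a b (t - p.1) p.2 * g p.1 p.2))
        ((volume.restrict (Ioc 0 t)).prod volume) :=
      hprod.bdd_mul (c := 1) (hec.comp continuous_snd).aestronglyMeasurable
        (Eventually.of_forall fun p => hen p.2)
    refine (h1.const_mul (2 * Real.pi * Complex.I : ℂ)).congr (Eventually.of_forall ?_)
    rintro ⟨s, ξ⟩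
    simp only [Function.uncurry]
    ring
  have hduh : ∀ ξ, ∫ s in (0 : ℝ)..t,
      e ξ * ((2 * Real.pi * Complex.I * ξ : ℂ) * heat a b (t - s) ξ * g s ξ) =
      2 * (e ξ * ((Real.pi * Complex.I * ξ : ℂ) * duh a b g t ξ)) := fun ξ => by
    rw [duh, ← intervalIntegral.integral_const_mul, ← intervalIntegral.integral_const_mul,
      ← intervalIntegral.integral_const_mul]
    refine intervalIntegral.integral_congr fun s _ => ?_
    simp only [heat]
    ring
  have hint1 : Integrable fun ξ => e ξ * (heat a b t ξ * fourierL2 u₀ ξ) :=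
    (integrable_mul_L2 (memLp_heat ha b ht) (Lp.memLp _)).bdd_mul (c := 1)
      hec.aestronglyMeasurable (Eventually.of_forall hen)
  have hint2 : Integrable fun ξ : ℝ => 2 * (e ξ * ((Real.pi * Complex.I * ξ : ℂ) * duh a b g t ξ)) := by
    have := hprod2.integral_prod_right
    refine this.congr (Eventually.of_forall fun ξ => ?_)
    simp only [Function.uncurry]
    rw [← hduh, intervalIntegral.integral_of_le ht.le]
  have h1 : conv (K a b t) u₀ x = ∫ ξ, e ξ * (heat a b t ξ * fourierL2 u₀ ξ) := by
    rw [K_eq, conv_fourierInv_L2 (integrable_heat ha b ht) (memLp_heat ha b ht),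
      fourierInv_real_eq]
  have h2 : ∫ s in (0 : ℝ)..t, conv (dxK a b (t - s)) (fun y => (u s y) ^ 2) x =
      ∫ ξ : ℝ, 2 * (e ξ * ((Real.pi * Complex.I * ξ : ℂ) * duh a b g t ξ)) := by
    have h3 : ∫ s in (0 : ℝ)..t, conv (dxK a b (t - s)) (fun y => (u s y) ^ 2) x =
        ∫ s in Ioc 0 t, ∫ ξ : ℝ,
          e ξ * ((2 * Real.pi * Complex.I * ξ : ℂ) * heat a b (t - s) ξ * g s ξ) := by
      -- The endpoint s = t is discarded: the kernel formula needs t - s > 0.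
      rw [intervalIntegral.integral_of_le ht.le, integral_Ioc_eq_integral_Ioo,
        integral_Ioc_eq_integral_Ioo]
      refine setIntegral_congr_fun measurableSet_Ioo fun s hs => ?_
      rw [conv_dxK_sq ha b (sub_pos.mpr hs.2), fourierInv_real_eq]
    rw [h3, integral_integral_swap hprod2]
    refine integral_congr_ae (Eventually.of_forall fun ξ => ?_)
    simp only
    rw [← hduh, intervalIntegral.integral_of_le ht.le]
  rw [h1, h2, fourierInv_real_eq, ← integral_const_mul, ← integral_sub hint1 (hint2.const_mul _)]
  refine integral_congr_ae (Eventually.of_forall fun ξ => ?_)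
  simp only [sol, heat, he]
  ring

theorem integrable_sol {a : ℝ} (ha : 0 < a) (b : ℝ) {u₀ : L2R} {n : ℕ} (hn : 1 ≤ n)
    (h0 : MemW (wt n) u₀) {g : ℝ → ℝ → ℂ} (hg : Continuous (Function.uncurry g)) {t T Γ : ℝ}
    (ht : t ∈ Icc 0 T) (hΓ : ∀ s ∈ Icc 0 T, ∀ ξ, wt n ξ * ‖g s ξ‖ ≤ Γ) :
    Integrable (sol a b (fourierL2 u₀) g t) ∧ MemLp (sol a b (fourierL2 u₀) g t) 2 := by
  obtain ⟨B, hB2, hB⟩ := (isWeight_wt n).exists_sol_dominated ha b h0 hΓ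
  have hm := aestronglyMeasurable_sol a b (Lp.aestronglyMeasurable (fourierL2 u₀)) hg t
  have hb : ∀ ξ, wt n ξ * ‖sol a b (fourierL2 u₀) g t ξ‖ ≤ B ξ := fun ξ => by
    have := hB t ht ξ
    rwa [norm_mul, (isWeight_wt n).norm_coe] at this
  refine ⟨(integrable_kf_mul hB2).mono' hm (Eventually.of_forall fun ξ =>
    le_kf_mul_of_wt_mul_le hn (norm_nonneg _) (hb ξ)), hB2.of_le hm
    (Eventually.of_forall fun ξ => ?_)⟩
  have h1 := (isWeight_wt n).one_le ξ
  refine le_trans ?_ ((hb ξ).trans (Real.le_norm_self _))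
  exact le_mul_of_one_le_left (norm_nonneg _) h1

/-- A real `L²` function is an inverse Fourier transform almost everywhere exactly when its
Fourier transform is the given function. -/
theorem ae_eq_fourierInv_iff {F : ℝ → ℂ} (h1 : Integrable F) (h2 : MemLp F 2) (f : L2R) :
    (∀ᵐ x : ℝ, ((f x : ℝ) : ℂ) = 𝓕⁻ F x) ↔ fourierL2 f =ᵐ[volume] F := by
  have e1 := fourierInv_toLp_ae_eq h1 h2
  have e2 := coeFn_toComplex f
  have e3 : fourierL2 f =ᵐ[volume] F ↔ fourierL2 f = h2.toLp F :=
    ⟨fun h => Lp.ext (h.trans h2.coeFn_toLp.symm), fun h => by rw [h]; exact h2.coeFn_toLp⟩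
  rw [e3]
  constructor
  · intro h
    have h3 : toComplex f = 𝓕⁻ (h2.toLp F) := by
      refine Lp.ext ?_
      filter_upwards [h, e1, e2] with x a1 a2 a3
      rw [a2, a3, a1]
    rw [fourierL2, h3, FourierTransform.fourier_fourierInv_eq]
  · intro h
    have h3 : toComplex f = 𝓕⁻ (h2.toLp F) := by
      rw [← h, fourierL2, FourierTransform.fourierInv_fourier_eq]
    filter_upwards [e1, e2] with x a2 a3
    rw [← a3, ← a2, h3]

/-! ### Mild solutions versus solutions of the truncated problem. -/

theorem norm_le_nw {c : ℝ} {w : ℝ → ℝ} (hw : IsWeight c w) {f : L2R} (hf : MemW w f) :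
    ‖f‖ ≤ nw w f := by
  have h := (hf.mono isWeight_one hw hw.one_le).2
  simpa [nw, n2_fourierL2] using h

theorem coeFn_mul_fourierL2_sub (w : ℝ → ℝ) (f g : L2R) :
    (fun ξ => (w ξ : ℂ) * fourierL2 (f - g) ξ) =ᵐ[volume]
      fun ξ => (w ξ : ℂ) * fourierL2 f ξ - (w ξ : ℂ) * fourierL2 g ξ := by
  rw [fourierL2_sub]
  filter_upwards [Lp.coeFn_sub (fourierL2 f) (fourierL2 g)] with ξ hξ
  rw [hξ, Pi.sub_apply, mul_sub]

theorem MemW.sub {w : ℝ → ℝ} {f g : L2R} (hf : MemW w f) (hg : MemW w g) : MemW w (f - g) :=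
  (memLp_congr_ae (coeFn_mul_fourierL2_sub w f g)).mpr (MemLp.sub hf hg)

theorem MemW.abs_nw_sub_le {w : ℝ → ℝ} {f g : L2R} (hf : MemW w f) (hg : MemW w g) :
    |nw w f - nw w g| ≤ nw w (f - g) := by
  unfold MemW at hf hg
  have h1 : nw w (f - g) = ‖hf.toLp _ - hg.toLp _‖ := by
    rw [nw, n2_congr (coeFn_mul_fourierL2_sub w f g), ← MemLp.toLp_sub]
    exact n2_eq_norm_toLp (hf.sub hg)
  rw [h1, nw, nw, n2_eq_norm_toLp hf, n2_eq_norm_toLp hg]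
  exact abs_norm_sub_norm_le _ _

section ContinuousInH

variable {n : ℕ} {T : ℝ} {v : ℝ → L2R}

theorem ContinuousInH.memW (hv : ContinuousInH n T v) {t : ℝ} (ht : t ∈ Icc 0 T) :
    MemW (wt n) (v t) := (memH_iff_memW n _).mp (hv.1 t ht)

theorem ContinuousInH.tendsto (hv : ContinuousInH n T v) {t : ℝ} (ht : t ∈ Icc 0 T) :
    Tendsto (fun s => nw (wt n) (v s - v t)) (𝓝[Icc 0 T] t) (𝓝 0) := by
  simpa only [normH_eq_nw] using hv.2 t ht

theorem ContinuousInH.continuousOn (hv : ContinuousInH n T v) : ContinuousOn v (Icc 0 T) := by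
  intro t ht
  rw [ContinuousWithinAt, tendsto_iff_norm_sub_tendsto_zero]
  refine squeeze_zero' (Eventually.of_forall fun _ => norm_nonneg _) ?_ (hv.tendsto ht)
  filter_upwards [self_mem_nhdsWithin] with s hs
  exact norm_le_nw (isWeight_wt n) ((hv.memW hs).sub (hv.memW ht))

theorem ContinuousInH.exists_nw_le (hv : ContinuousInH n T v) :
    ∃ M, 0 ≤ M ∧ ∀ s ∈ Icc 0 T, nw (wt n) (v s) ≤ M := by
  have hc : ContinuousOn (fun s => nw (wt n) (v s)) (Icc 0 T) := by
    intro t ht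
    rw [ContinuousWithinAt, tendsto_iff_norm_sub_tendsto_zero]
    refine squeeze_zero' (Eventually.of_forall fun _ => norm_nonneg _) ?_ (hv.tendsto ht)
    filter_upwards [self_mem_nhdsWithin] with s hs
    exact (hv.memW hs).abs_nw_sub_le (hv.memW ht)
  obtain ⟨M, hM⟩ := isCompact_Icc.exists_bound_of_continuousOn hc
  exact ⟨max M 0, le_max_right _ _, fun s hs =>
    (Real.le_norm_self _).trans ((hM s hs).trans (le_max_left _ _))⟩

theorem ContinuousInH.exists_mul_norm_fourierMul_le (hv : ContinuousInH n T v) :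
    ∃ Γ, ∀ s ∈ Icc 0 T, ∀ ξ, wt n ξ * ‖fourierMul (v s) (v s) ξ‖ ≤ Γ := by
  obtain ⟨M, hM0, hM⟩ := hv.exists_nw_le
  refine ⟨2 * 2 ^ n * M * M, fun s hs ξ => ?_⟩
  refine ((isWeight_wt n).mul_norm_fourierMul_self_le (hv.memW hs) ξ).trans ?_
  have h1 := (norm_le_nw (isWeight_wt n) (hv.memW hs)).trans (hM s hs)
  exact mul_le_mul (by gcongr) (hM s hs) (nw_nonneg _ _) (by positivity)

end ContinuousInH

theorem sol_trunc_eq (a b : ℝ) (c : ℝ → ℂ) {R T : ℝ} (hR : 0 < R) {u : ℝ → L2R}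
    (h : ∀ s ∈ Icc 0 T, ‖u s‖ ≤ R) {t : ℝ} (ht : t ∈ Icc 0 T) :
    sol a b c (fun s ξ => trunc R (u s) ξ) t =
      sol a b c (fun s ξ => fourierMul (u s) (u s) ξ) t := by
  funext ξ
  rw [sol, sol, duh_congr a b ht.1 fun s hs => ?_]
  rw [trunc, retr_eq_self hR (h s ⟨hs.1, hs.2.trans ht.2⟩)]

/-- Inside both balls neither truncation acts, so the radius can be changed. -/
theorem TruncSol.of_norm_le {a b R R' T : ℝ} {u₀ : L2R} {u : ℝ → L2R} (hR : 0 < R)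
    (hR' : 0 < R') (hu : TruncSol a b R T u₀ u) (h : ∀ s ∈ Icc 0 T, ‖u s‖ ≤ R)
    (h' : ∀ s ∈ Icc 0 T, ‖u s‖ ≤ R') : TruncSol a b R' T u₀ u where
  continuous := hu.continuous
  eq t ht := by
    rw [sol_trunc_eq a b _ hR' h' ht, ← sol_trunc_eq a b _ hR h ht]
    exact hu.eq t ht

theorem continuous_uncurry_fourierMul {u : ℝ → L2R} (hu : Continuous u) :
    Continuous (Function.uncurry fun s ξ => fourierMul (u s) (u s) ξ) :=
  (continuous_fourierMul_self.comp ((hu.comp continuous_fst).prodMk continuous_snd)).congr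
    fun _ => rfl

theorem TruncSol.isMildSolution {a b R T : ℝ} {n : ℕ} (hn : 1 ≤ n) (ha : 0 < a) (hT : 0 < T)
    (hR : 0 < R) {u₀ : L2R} {u : ℝ → L2R} (hu : TruncSol a b R T u₀ u) (h0 : MemW (wt n) u₀)
    (h : ∀ s ∈ Icc 0 T, ‖u s‖ ≤ R) : IsMildSolution a b n T u₀ u := by
  have hH : ContinuousInH n T u := by
    refine ⟨fun t ht => (memH_iff_memW n _).mpr (hu.memW_and_nw_le ha hR h0 ht).1,
      fun t ht => ?_⟩
    simpa only [normH_eq_nw] using hu.tendsto_nw_sub ha hR h0 ht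
  refine ⟨hH, ?_, fun t ht => ?_⟩
  · refine fourierL2_injective (Lp.ext ?_)
    filter_upwards [hu.eq 0 ⟨le_rfl, hT.le⟩] with ξ hξ
    rw [hξ, sol_zero]
  · obtain ⟨Γ, hΓ⟩ := hH.exists_mul_norm_fourierMul_le
    have ht' : t ∈ Icc 0 T := Ioc_subset_Icc_self ht
    have hsol := integrable_sol ha b hn h0 (continuous_uncurry_fourierMul hu.continuous) ht' hΓ
    simp only [duhamel_rhs_eq ha b u₀ hu.continuous hn ht.1
      fun s hs => hΓ s ⟨hs.1, hs.2.trans ht.2⟩]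
    rw [ae_eq_fourierInv_iff hsol.1 hsol.2, ← sol_trunc_eq a b _ hR h ht']
    exact hu.eq t ht'

/-- A mild solution is bounded in L² on [0,T], so no truncation at a larger radius sees it. This
carries uniqueness over from the truncated problem. -/
theorem IsMildSolution.exists_truncSol {a b T : ℝ} {n : ℕ} (hn : 1 ≤ n) (ha : 0 < a)
    (hT : 0 < T) {u₀ : L2R} {v : ℝ → L2R} (hv : IsMildSolution a b n T u₀ v)
    (h0 : MemW (wt n) u₀) :
    ∃ v' : ℝ → L2R, EqOn v' v (Icc 0 T) ∧ ∃ M, ∀ R, 0 < R → M ≤ R → TruncSol a b R T u₀ v' := by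
  -- A mild solution is controlled only on [0,T]; freezing it outside makes it globally continuous,
  -- as `TruncSol` requires.
  set v' : ℝ → L2R := fun s => v (projIcc 0 T hT.le s) with hv'
  have heq : EqOn v' v (Icc 0 T) := fun s hs => by simp only [hv', projIcc_of_mem hT.le hs]
  have hc : Continuous v' := hv.continuousInH.continuousOn.comp_continuous
    (continuous_subtype_val.comp continuous_projIcc) fun s => (projIcc 0 T hT.le s).2
  obtain ⟨Γ, hΓ⟩ := hv.continuousInH.exists_mul_norm_fourierMul_le
  have hΓ' : ∀ s ∈ Icc 0 T, ∀ ξ, wt n ξ * ‖fourierMul (v' s) (v' s) ξ‖ ≤ Γ := fun s hs => by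
    rw [heq hs]
    exact hΓ s hs
  obtain ⟨M, -, hM⟩ := exists_norm_le_on_Icc (T := T) hc
  refine ⟨v', heq, M, fun R hR hMR => ⟨hc, fun t ht => ?_⟩⟩
  rw [sol_trunc_eq a b _ hR (fun s hs => (hM s hs).trans hMR) ht, heq ht]
  rcases ht.1.eq_or_lt with rfl | ht0
  · rw [hv.initial]
    exact Eventually.of_forall fun ξ => (sol_zero _ _ _ _ _).symm
  · have hsol := integrable_sol ha b hn h0 (continuous_uncurry_fourierMul hc) ht hΓ'
    rw [← ae_eq_fourierInv_iff hsol.1 hsol.2]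
    filter_upwards [hv.duhamel t ⟨ht0, ht.2⟩] with x hx
    rw [hx, ← duhamel_rhs_eq ha b u₀ hc hn ht0 fun s hs => hΓ' s ⟨hs.1, hs.2.trans ht.2⟩]
    congr 2
    refine intervalIntegral.integral_congr fun s hs => ?_
    rw [uIcc_of_le ht.1] at hs
    simp only [heq (⟨hs.1, hs.2.trans ht.2⟩ : s ∈ Icc 0 T)]

/-! ### The constants and the conclusion. -/

/-- A bound on the `L²` norm of the solution on `[0,T]`, in terms of the norm `r` of the
initial value. -/
def radius (a T r : ℝ) : ℝ := Real.exp (a ^ 3 * max T 0) * max r 0 + 1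

/-- The constant in the bound on the Sobolev norm of the solution. -/
def growth (a : ℝ) (n : ℕ) (T r : ℝ) : ℝ :=
  2 * Real.exp ((a ^ 3 + rate n (radius a T r) ^ 4) * max T 0)

theorem radius_pos (a T r : ℝ) : 0 < radius a T r := by
  unfold radius
  positivity

theorem radius_mono {a : ℝ} (ha : 0 < a) {T T' r r' : ℝ} (hT : T ≤ T') (hr : r ≤ r') :
    radius a T r ≤ radius a T' r' := by
  unfold radius
  gcongr

/-- The cutoffs `max T 0` and `max r 0` keep the factors nonnegative, so that monotonicity holds for
all real arguments. -/
theorem growth_mono {a : ℝ} (ha : 0 < a) (n : ℕ) {T T' r r' : ℝ} (hT : T ≤ T') (hr : r ≤ r') :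
    growth a n T r ≤ growth a n T' r' := by
  have h1 := radius_mono ha hT hr
  have h2 := one_le_rate n (radius_pos a T r).le
  have h3 : rate n (radius a T r) ≤ rate n (radius a T' r') := by
    unfold rate
    gcongr
  have h4 : 0 < rate n (radius a T r) := by linarith
  unfold growth
  gcongr

end Fowler

end

theorem mainTheorem5 (a b : ℝ) (ha : 0 < a) (hb : 0 < b) (n : ℕ) (hn : 1 ≤ n) :
    ∃ C : ℝ → ℝ → ℝ,
      (∀ T r, 0 < C T r) ∧ (∀ T, Monotone (C T)) ∧ (∀ r, Monotone fun T => C T r) ∧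
      ∀ T : ℝ, 0 < T → ∀ u₀ : Fowler.L2R, Fowler.MemH n u₀ →
        ∃ u : ℝ → Fowler.L2R, Fowler.IsMildSolution a b n T u₀ u ∧
          (∀ v : ℝ → Fowler.L2R, Fowler.IsMildSolution a b n T u₀ v → EqOn v u (Icc 0 T)) ∧
          ∀ t ∈ Icc 0 T,
            Fowler.normH n (u t) ≤ C T (Fowler.normH (n - 1) u₀) * Fowler.normH n u₀ := by
  open Fowler in
  refine ⟨growth a n, fun T r => by unfold growth; positivity,
    fun T r r' h => growth_mono ha n le_rfl h, fun r T T' h => growth_mono ha n h le_rfl,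
    fun T hT u₀ hu₀ => ?_⟩
  have h0 : MemW (wt n) u₀ := (memH_iff_memW n u₀).mp hu₀
  have h1 : MemW (wt 1) u₀ := (h0.mono (isWeight_wt 1) (isWeight_wt n) (wt_mono hn)).1
  have h2 : MemW (wt (n - 1)) u₀ :=
    (h0.mono (isWeight_wt (n - 1)) (isWeight_wt n) (wt_mono (Nat.sub_le n 1))).1
  set R := radius a T (normH (n - 1) u₀) with hRdef
  have hR : 0 < R := radius_pos _ _ _
  obtain ⟨u, hu⟩ := exists_truncSol ha b hR hT.le u₀
  have hle : ∀ s ∈ Icc 0 T, ‖u s‖ ≤ R := fun s hs => by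
    -- The H^{n-1} norm enters only here, as an upper bound for the L² norm.
    have h3 : ‖u₀‖ ≤ max (normH (n - 1) u₀) 0 := by
      rw [normH_eq_nw]
      exact (norm_le_nw (isWeight_wt _) h2).trans (le_max_left _ _)
    have h4 : s ≤ max T 0 := hs.2.trans (le_max_left _ _)
    calc ‖u s‖ ≤ Real.exp (a ^ 3 * s) * ‖u₀‖ := hu.norm_le ha hR h1 hs
      _ ≤ Real.exp (a ^ 3 * max T 0) * max (normH (n - 1) u₀) 0 := by gcongr
      _ ≤ R := by rw [hRdef, radius]; linarith
  refine ⟨u, hu.isMildSolution hn ha hT hR h0 hle, fun v hv => ?_, fun t ht => ?_⟩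
  · obtain ⟨v', hv', M, hM⟩ := hv.exists_truncSol hn ha hT h0
    -- A common radius at which the truncation is inactive for both solutions.
    have hR' : 0 < max R M := hR.trans_le (le_max_left _ _)
    have hu' := hu.of_norm_le hR hR' hle fun s hs => (hle s hs).trans (le_max_left _ _)
    exact hv'.symm.trans ((hM _ hR' (le_max_right _ _)).unique ha hR' hu')
  · rw [normH_eq_nw, normH_eq_nw n u₀]
    refine (hu.memW_and_nw_le ha hR h0 ht).2.trans ?_
    have h3 := nw_nonneg (wt n) u₀
    have h4 := rate_pow_pos n hR
    have h5 : t ≤ max T 0 := ht.2.trans (le_max_left _ _)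
    rw [growth, mul_right_comm]
    gcongr
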